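/- Let $\mathcal M=\{1,\dots,M\}$ with $M\ge 1$, let $\gamma>0$, and for $m\in\mathcal M$ let $A^m,D^m\in\mathbb R^{n\times n}$ and $\sigma^m\in\mathbb R^{n\times k}$. Consider the value function $$V(x)=\sup_{w}\sup_{\mu}\sup_{T>0}\int_0^T \tfrac12\,\xi_t'D^{\mu_t}\xi_t-\tfrac{\gamma^2}{2}|w_t|^2\,dt,\qquad \dot\xi=A^{\mu_t}\xi+\sigma^{\mu_t}w_t,\quad \xi_0=x\in\mathbb R^n,$$ where $\mu:[0,\infty)\to\mathcal M$ is measurable and $w:[0,\infty)\to\mathbb R^k$ is locally square integrable. For $m\in\mathcal M$ and $\tau>0$ let $$S^m_\tau[V^0](x)=\sup_w\Big\{\int_0^\tau \tfrac12\,\xi_t'D^{m}\xi_t-\tfrac{\gamma^2}{2}|w_t|^2\,dt+V^0(\xi_\tau)\Big\},\qquad \dot\xi=A^m\xi+\sigma^mw,\quad \xi_0=x,$$ and $\tilde S_\tau=\sup_{m\in\mathcal M}S^m_\tau$. The max-plus method with time step $\tau$ and $N$ iterations, started from $V^0(x)=\frac12x'P_0x$, approximates $V$ by $$\{\tilde S_\tau\}^N[V^0]=\sup_{i_1,\dots,i_N\in\mathcal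 M}S_\tau^{i_N}\cdots S_\tau^{i_1}[V^0].$$ Assume that there are constants $c_A,c_\sigma,m_D>0$ and $c_D$ such that, for all $m\in\mathcal M$ and all $x$: * (Assumption 1) $x'A^mx\le -c_A|x|^2$; $|\sigma^m|\le c_\sigma$ (operator norm); $D^m$ is symmetric positive definite with $x'D^mx\le c_D|x|^2$; and $c_A^2>c_Dc_\sigma^2/\gamma^2$; * (Assumption 2) $x'D^mx\ge m_D|x|^2$ and $\frac{c_\sigma^2}{\gamma^2}m_D>\big(c_A-\sqrt{c_A^2-c_Dc_\sigma^2/\gamma^2}\big)^2$. Fix $\lambda<\lambda_2:=\sqrt{m_D\gamma^2/c_\sigma^2}$ and $e>0$. A function $f$ is said to approximate $g$ to accuracy $\varepsilon$ if both are finite and $|f(x)-g(x)|\le\varepsilon|x|^2$ for all $x\in\mathbb R^n$. Then there is a constant $C>0$, depending on the problem data, $\lambda$ and $e$, such that for all sufficiently small $\varepsilon>0$ there are a time step $\tau>0$ and a number of iterations $$N\le C\,\frac{-\log\varepsilon}{\varepsilon}$$ for which the following holds for every initial matrix $P_0$ with $eI\le P_0\le\lambda I$. 1. *Iterations.* $\{\tilde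 S_\tau\}^N[V^0]$ approximates $V$ to accuracy $\varepsilon$. 2. *Arithmetic cost.* The $M^N$ quadratic functions of the method can be computed, to accuracy $\varepsilon$, by additions, subtractions and multiplications of real numbers: there is a straight-line program, depending only on $n,M,N$, whose inputs are $\tau$ and the entries of $P_0$ and of $A^m,D^m,\Sigma^m=\gamma^{-2}\sigma^m(\sigma^m)'$ ($m\in\mathcal M$), together with rational constants, and whose outputs are matrices $Q_{i_1\cdots i_N}$, such that $\frac12x'Q_{i_1\cdots i_N}x$ approximates $S_\tau^{i_N}\cdots S_\tau^{i_1}[V^0]$ to accuracy $\varepsilon$ for each word $i_1\cdots i_N\in\mathcal M^N$, and $\sup_{i_1,\dots,i_N}\frac12x'Q_{i_1\cdots i_N}x$ approximates $V$ to accuracy $\varepsilon$. If $M\ge2$, the number of operations of this program is at most $$c\,|\mathcal M|^{\,C(-\log\varepsilon)/\varepsilon}\,n^3,$$ where $c$ is an absolute constant. -/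

import Mathlib

open scoped Matrix Topology
open MeasureTheory

/-! ### The switching linear quadratic control problem

Vectors of `ℝⁿ` are functions `Fin n → ℝ`; the Euclidean square norm `|x|²` is always written
`x ⬝ᵥ x`, so that the sup norm carried by this type plays no role. Value functions take values in
the extended reals: no supremum is ever replaced by a default value. -/

/-- The data of a switching linear quadratic optimal control problem with state space `ℝⁿ`,
disturbances in `ℝᵏ` and switching index set `{1, …, M}`. -/
structure SwitchingLQ (n k M : ℕ) where
  A : Fin M → Matrix (Fin n) (Fin n) ℝ
  sig : Fin M → Matrix (Fin n) (Fin k) ℝ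
  D : Fin M → Matrix (Fin n) (Fin n) ℝ
  γ : ℝ

namespace SwitchingLQ

variable {n k M : ℕ}

/-- The first assumption on the data, with constants `cA`, `cσ`, `cD`. The bound `|σᵐ| ≤ cσ` is
the one on the operator norm. -/
structure Assumption1 (p : SwitchingLQ n k M) (cA cσ cD : ℝ) : Prop where
  γ_pos : 0 < p.γ
  cA_pos : 0 < cA
  cσ_pos : 0 < cσ
  stable : ∀ (m : Fin M) (x : Fin n → ℝ), x ⬝ᵥ (p.A m *ᵥ x) ≤ -cA * (x ⬝ᵥ x)
  sig_le : ∀ (m : Fin M) (w : Fin k → ℝ),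
    (p.sig m *ᵥ w) ⬝ᵥ (p.sig m *ᵥ w) ≤ cσ ^ 2 * (w ⬝ᵥ w)
  D_posDef : ∀ m : Fin M, (p.D m).PosDef
  D_le : ∀ (m : Fin M) (x : Fin n → ℝ), x ⬝ᵥ (p.D m *ᵥ x) ≤ cD * (x ⬝ᵥ x)
  gap : cD * cσ ^ 2 / p.γ ^ 2 < cA ^ 2

/-- The second assumption on the data, with the further constant `mD`. -/
structure Assumption2 (p : SwitchingLQ n k M) (cA cσ cD mD : ℝ) : Prop where
  mD_pos : 0 < mD
  le_D : ∀ (m : Fin M) (x : Fin n → ℝ), mD * (x ⬝ᵥ x) ≤ x ⬝ᵥ (p.D m *ᵥ x)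
  gap : (cA - √(cA ^ 2 - cD * cσ ^ 2 / p.γ ^ 2)) ^ 2 < cσ ^ 2 / p.γ ^ 2 * mD

/-- The admissible disturbances: `w : [0, ∞) → ℝᵏ` measurable with `∫₀ᵀ |w|² < ∞` for all `T`
(the values at negative times are irrelevant). -/
def IsDisturbance (w : ℝ → Fin k → ℝ) : Prop :=
  ∀ T : ℝ, AEStronglyMeasurable w (volume.restrict (Set.Icc 0 T)) ∧
    IntegrableOn (fun t => w t ⬝ᵥ w t) (Set.Icc 0 T)

/-- `ξ` solves `ξ' = A^{μ} ξ + σ^{μ} w`, `ξ₀ = x` on `[0, T]` in the sense of Carathéodory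
(integrated form of the equation). -/
def IsTrajectory (p : SwitchingLQ n k M) (x : Fin n → ℝ) (T : ℝ) (w : ℝ → Fin k → ℝ)
    (μ : ℝ → Fin M) (ξ : ℝ → Fin n → ℝ) : Prop :=
  ContinuousOn ξ (Set.Icc 0 T) ∧
    ∀ t ∈ Set.Icc 0 T,
      ξ t = x + ∫ s in (0 : ℝ)..t, (p.A (μ s) *ᵥ ξ s + p.sig (μ s) *ᵥ w s)

/-- The running payoff `∫₀ᵀ ½ ξ' D^{μ} ξ - (γ²/2) |w|² dt`. -/
noncomputable def running (p : SwitchingLQ n k M) (T : ℝ) (w : ℝ → Fin k → ℝ)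
    (μ : ℝ → Fin M) (ξ : ℝ → Fin n → ℝ) : ℝ :=
  ∫ t in (0 : ℝ)..T,
    ((1 / 2) * (ξ t ⬝ᵥ (p.D (μ t) *ᵥ ξ t)) - p.γ ^ 2 / 2 * (w t ⬝ᵥ w t))

/-- The value function `V` of the infinite horizon problem. -/
noncomputable def value (p : SwitchingLQ n k M) (x : Fin n → ℝ) : EReal :=
  ⨆ (w : ℝ → Fin k → ℝ) (_ : IsDisturbance w) (μ : ℝ → Fin M) (_ : Measurable μ)
    (T : ℝ) (_ : 0 < T) (ξ : ℝ → Fin n → ℝ) (_ : p.IsTrajectory x T w μ ξ),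
    ((p.running T w μ ξ : ℝ) : EReal)

/-- The semigroup `Sᵐ_T` of the problem in which the index is frozen to `m`. -/
noncomputable def semigroupAt (p : SwitchingLQ n k M) (m : Fin M) (T : ℝ)
    (V₀ : (Fin n → ℝ) → EReal) (x : Fin n → ℝ) : EReal :=
  ⨆ (w : ℝ → Fin k → ℝ) (_ : IsDisturbance w) (ξ : ℝ → Fin n → ℝ)
    (_ : p.IsTrajectory x T w (fun _ => m) ξ),
    ((p.running T w (fun _ => m) ξ : ℝ) : EReal) + V₀ (ξ T)

/-- One iteration of the max-plus method: `S̃_τ = sup_m Sᵐ_τ`. -/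
noncomputable def maxPlusStep (p : SwitchingLQ n k M) (τ : ℝ)
    (V₀ : (Fin n → ℝ) → EReal) (x : Fin n → ℝ) : EReal :=
  ⨆ m : Fin M, p.semigroupAt m τ V₀ x

/-- `N` iterations of the max-plus method started from `V₀`: the function `{S̃_τ}ᴺ[V₀]`. -/
noncomputable def maxPlusIterate (p : SwitchingLQ n k M) (τ : ℝ) (N : ℕ)
    (V₀ : (Fin n → ℝ) → EReal) : (Fin n → ℝ) → EReal :=
  (p.maxPlusStep τ)^[N] V₀

/-- The function `S_τ^{i_N} ⋯ S_τ^{i_1}[V₀]` propagated along the word `(i_1, …, i_N)`. -/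
noncomputable def propagate (p : SwitchingLQ n k M) (τ : ℝ) {N : ℕ} (i : Fin N → Fin M)
    (V₀ : (Fin n → ℝ) → EReal) : (Fin n → ℝ) → EReal :=
  (List.ofFn i).foldl (fun f m => p.semigroupAt m τ f) V₀

end SwitchingLQ

/-- The quadratic function `x ↦ ½ x' P x`. -/
noncomputable def quadFun {n : ℕ} (P : Matrix (Fin n) (Fin n) ℝ) (x : Fin n → ℝ) : EReal :=
  (((1 / 2) * (x ⬝ᵥ (P *ᵥ x)) : ℝ) : EReal)

/-- `f` and `g` are finite everywhere and `|f(x) - g(x)| ≤ ε |x|²` for all `x`. -/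
def ApproxWithin {n : ℕ} (ε : ℝ) (f g : (Fin n → ℝ) → EReal) : Prop :=
  ∀ x, ∃ a b : ℝ, f x = (a : EReal) ∧ g x = (b : EReal) ∧ |a - b| ≤ ε * (x ⬝ᵥ x)

/-- The order interval `[a I, b I]` of symmetric matrices for the Loewner order. -/
def loewnerInterval (n : ℕ) (a b : ℝ) : Set (Matrix (Fin n) (Fin n) ℝ) :=
  {P | (P - a • (1 : Matrix (Fin n) (Fin n) ℝ)).PosSemidef ∧
    (b • (1 : Matrix (Fin n) (Fin n) ℝ) - P).PosSemidef}

/-! ### Arithmetic operations -/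

/-- The numerical input of the method: the coefficients `Aᵐ, Dᵐ, Σᵐ` of the quadratic
Hamiltonians, the time step `τ` and the matrix `P` of the initial quadratic function. -/
structure MethodInput (n M : ℕ) where
  A : Fin M → Matrix (Fin n) (Fin n) ℝ
  D : Fin M → Matrix (Fin n) (Fin n) ℝ
  S : Fin M → Matrix (Fin n) (Fin n) ℝ
  τ : ℝ
  P : Matrix (Fin n) (Fin n) ℝ

/-- The input attached to a problem. Here `Σᵐ = γ⁻² σᵐ (σᵐ)'` is the matrix for which
`sup_w (p' σᵐ w - (γ²/2) |w|²) = ½ p' Σᵐ p`. -/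
noncomputable def SwitchingLQ.input {n k M : ℕ} (p : SwitchingLQ n k M) (τ : ℝ)
    (P : Matrix (Fin n) (Fin n) ℝ) : MethodInput n M where
  A := p.A
  D := p.D
  S := fun m => (1 / p.γ ^ 2) • (p.sig m * (p.sig m)ᵀ)
  τ := τ
  P := P

/-- What is available before any operation: the entries of the input and rational constants,
all seen as functions of the input. -/
def initialValues (n M : ℕ) : Set (MethodInput n M → ℝ) :=
  {f | (∃ q : ℚ, f = fun _ => (q : ℝ)) ∨ (∃ m i j, f = fun X => X.A m i j) ∨
    (∃ m i j, f = fun X => X.D m i j) ∨ (∃ m i j, f = fun X => X.S m i j) ∨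
    (f = fun X => X.τ) ∨ (∃ i j, f = fun X => X.P i j)}

/-- `StraightLine I t G`: some straight-line program which starts from the values in `I` and
performs `t` arithmetic operations (additions, subtractions, multiplications), each of them on
values which are already available, has `G` as its set of available values at the end. Values are
functions of the input `X`, so that one program serves all inputs. -/
inductive StraightLine {X : Type} (I : Set (X → ℝ)) : ℕ → Set (X → ℝ) → Prop
  | start : StraightLine I 0 I
  | add {t : ℕ} {G : Set (X → ℝ)} {f g : X → ℝ} :
      StraightLine I t G → f ∈ G → g ∈ G → StraightLine I (t + 1) (insert (fun x => f x + g x) G)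
  | sub {t : ℕ} {G : Set (X → ℝ)} {f g : X → ℝ} :
      StraightLine I t G → f ∈ G → g ∈ G → StraightLine I (t + 1) (insert (fun x => f x - g x) G)
  | mul {t : ℕ} {G : Set (X → ℝ)} {f g : X → ℝ} :
      StraightLine I t G → f ∈ G → g ∈ G → StraightLine I (t + 1) (insert (fun x => f x * g x) G)

/-- The matrices `Q i`, one for each word `i ∈ {1, …, M}ᴺ`, are obtained from the input by a
straight-line program with `t` arithmetic operations. -/
def ComputedWith {n M N : ℕ}
    (Q : (Fin N → Fin M) → MethodInput n M → Matrix (Fin n) (Fin n) ℝ) (t : ℕ) : Prop :=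
  ∃ G, StraightLine (initialValues n M) t G ∧ ∀ i a b, (fun X => Q i X a b) ∈ G

/-!
On quadratic forms, one Euler step of the Riccati equation with step `τ` agrees with the semigroup
up to `O(τ²)`. Some multiple `R` of the identity above the initial matrix has negative definite
Riccati residual and `D - R S R` positive definite for every mode, so that between `0` and `R` the
Riccati operator is strictly non-homogeneous: rescaling a form by `1 ± cτ` gains more than the
`O(τ²)` error costs. The errors of the single steps therefore do not accumulate but are absorbed
into one factor `1 ± cτ`, whatever the number of iterations. The same non-homogeneity makes the
iterates, which stay below `R`, forget their initial value at a geometric rate `1 - κτ`. Hence `τ`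
of order `ε` and `N` of order `log (1/ε) / ε` suffice, and the `M + ⋯ + M ^ N` Euler steps cost
`O(n³)` operations each.
-/

/-! ### Absolutely continuous functions with a given derivative -/

/-- `f` is absolutely continuous on the interval between `a` and `b`, with almost everywhere
derivative `f'`: the regularity for which the fundamental theorem of calculus holds along
trajectories driven by merely measurable controls. -/
def HasACDeriv (a b : ℝ) (f f' : ℝ → ℝ) : Prop :=
  AbsolutelyContinuousOnInterval f a b ∧ ∀ᵐ t, t ∈ Set.uIcc a b → HasDerivAt f (f' t) t

namespace HasACDeriv

variable {a b : ℝ} {f f' g g' : ℝ → ℝ}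

theorem deriv_ae_eq (hf : HasACDeriv a b f f') :
    deriv f =ᵐ[volume.restrict (Set.uIoc a b)] f' := by
  rw [Filter.EventuallyEq, ae_restrict_iff' measurableSet_uIoc]
  filter_upwards [hf.2] with t ht htm
  exact (ht (Set.uIoc_subset_uIcc htm)).deriv

theorem intervalIntegrable (hf : HasACDeriv a b f f') : IntervalIntegrable f' volume a b :=
  hf.1.intervalIntegrable_deriv.congr_ae hf.deriv_ae_eq

theorem integral_eq_sub (hf : HasACDeriv a b f f') : ∫ t in a..b, f' t = f b - f a := by
  rw [← hf.1.integral_deriv_eq_sub]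
  exact intervalIntegral.integral_congr_ae_restrict hf.deriv_ae_eq.symm

theorem mul (hf : HasACDeriv a b f f') (hg : HasACDeriv a b g g') :
    HasACDeriv a b (fun t => f t * g t) (fun t => f' t * g t + f t * g' t) := by
  refine ⟨hf.1.mul hg.1, ?_⟩
  filter_upwards [hf.2, hg.2] with t hft hgt ht
  exact (hft ht).mul (hgt ht)

theorem add (hf : HasACDeriv a b f f') (hg : HasACDeriv a b g g') :
    HasACDeriv a b (fun t => f t + g t) (fun t => f' t + g' t) := by
  refine ⟨hf.1.add hg.1, ?_⟩
  filter_upwards [hf.2, hg.2] with t hft hgt ht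
  exact (hft ht).add (hgt ht)

theorem mul_const (hf : HasACDeriv a b f f') (c : ℝ) :
    HasACDeriv a b (fun t => f t * c) (fun t => f' t * c) := by
  refine ⟨by simpa only [mul_comm _ c] using hf.1.const_mul c, ?_⟩
  filter_upwards [hf.2] with t hft ht
  exact (hft ht).mul_const c

theorem of_hasDerivAt (hf : ∀ t, HasDerivAt f (f' t) t) (hf' : Continuous f') :
    HasACDeriv a b f f' := by
  refine ⟨ContDiffOn.absolutelyContinuousOnInterval ?_, .of_forall fun t _ => hf t⟩
  refine (contDiff_one_iff_deriv.2 ⟨fun t => (hf t).differentiableAt, ?_⟩).contDiffOn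
  rwa [show deriv f = f' from funext fun t => (hf t).deriv]

theorem const (c : ℝ) : HasACDeriv a b (fun _ => c) (fun _ => 0) :=
  of_hasDerivAt (fun t => hasDerivAt_const t c) continuous_const

theorem sum {ι : Type*} (s : Finset ι) {f f' : ι → ℝ → ℝ}
    (hf : ∀ i ∈ s, HasACDeriv a b (f i) (f' i)) :
    HasACDeriv a b (fun t => ∑ i ∈ s, f i t) (fun t => ∑ i ∈ s, f' i t) := by
  classical
  induction s using Finset.induction_on with
  | empty => simpa using const 0
  | insert i s hi ih =>
    simp only [Finset.sum_insert hi]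
    exact (hf i (by simp)).add (ih fun j hj => hf j (by simp [hj]))

theorem const_add_integral (c : ℝ) (hf : IntervalIntegrable f' volume a b) :
    HasACDeriv a b (fun t => c + ∫ s in a..t, f' s) f' := by
  refine ⟨((const c).1.add
    (hf.absolutelyContinuousOnInterval_intervalIntegral Set.left_mem_uIcc) :), ?_⟩
  filter_upwards [hf.ae_hasDerivAt_integral] with t ht htm
  exact (ht htm a Set.left_mem_uIcc).const_add c

theorem dotProduct_mulVec {n : ℕ} {ξ ξ' : ℝ → Fin n → ℝ} {P P' : ℝ → Matrix (Fin n) (Fin n) ℝ}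
    (hξ : ∀ i, HasACDeriv a b (fun t => ξ t i) (fun t => ξ' t i))
    (hP : ∀ i j, HasACDeriv a b (fun t => P t i j) (fun t => P' t i j)) :
    HasACDeriv a b (fun t => ξ t ⬝ᵥ (P t *ᵥ ξ t))
      (fun t => ξ' t ⬝ᵥ (P t *ᵥ ξ t) + ξ t ⬝ᵥ (P' t *ᵥ ξ t) + ξ t ⬝ᵥ (P t *ᵥ ξ' t)) := by
  have h := HasACDeriv.sum Finset.univ fun i _ => (hξ i).mul
    (HasACDeriv.sum Finset.univ fun j _ => (hP i j).mul (hξ j))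
  simpa only [dotProduct, Matrix.mulVec, Finset.sum_add_distrib, mul_add, add_assoc] using h

end HasACDeriv

/-! ### Quadratic forms and the Riccati operator -/

/-- The real-valued quadratic form `½ x' P x`; `quadFun P` is its coercion to `EReal`. -/
noncomputable def quadForm {n : ℕ} (P : Matrix (Fin n) (Fin n) ℝ) (x : Fin n → ℝ) : ℝ :=
  (1 / 2) * (x ⬝ᵥ (P *ᵥ x))

/-- The Riccati operator `P ↦ A'P + PA + PSP + D`. -/
def riccati {n : ℕ} (A D S P : Matrix (Fin n) (Fin n) ℝ) : Matrix (Fin n) (Fin n) ℝ :=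
  Aᵀ * P + P * A + P * S * P + D

section Matrices

variable {n k : ℕ}

theorem dotProduct_self_nonneg_real (x : Fin n → ℝ) : 0 ≤ x ⬝ᵥ x := by
  simpa using dotProduct_star_self_nonneg x

theorem dotProduct_mulVec_eq_transpose (B : Matrix (Fin n) (Fin k) ℝ) (x : Fin n → ℝ)
    (y : Fin k → ℝ) : x ⬝ᵥ (B *ᵥ y) = (Bᵀ *ᵥ x) ⬝ᵥ y := by
  rw [Matrix.dotProduct_mulVec, Matrix.mulVec_transpose]

theorem dotProduct_mulVec_comm_of_isSymm {P : Matrix (Fin n) (Fin n) ℝ} (hP : P.IsSymm)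
    (x y : Fin n → ℝ) : x ⬝ᵥ (P *ᵥ y) = (P *ᵥ x) ⬝ᵥ y := by
  rw [dotProduct_mulVec_eq_transpose, hP.eq]

theorem quadFun_eq_coe (P : Matrix (Fin n) (Fin n) ℝ) (x : Fin n → ℝ) :
    quadFun P x = (quadForm P x : EReal) := rfl

theorem quadForm_add (P Q : Matrix (Fin n) (Fin n) ℝ) (x : Fin n → ℝ) :
    quadForm (P + Q) x = quadForm P x + quadForm Q x := by
  simp only [quadForm, Matrix.add_mulVec, dotProduct_add, mul_add]

theorem quadForm_sub (P Q : Matrix (Fin n) (Fin n) ℝ) (x : Fin n → ℝ) :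
    quadForm (P - Q) x = quadForm P x - quadForm Q x := by
  simp only [quadForm, Matrix.sub_mulVec, dotProduct_sub, mul_sub]

theorem quadForm_smul (c : ℝ) (P : Matrix (Fin n) (Fin n) ℝ) (x : Fin n → ℝ) :
    quadForm (c • P) x = c * quadForm P x := by
  simp only [quadForm, Matrix.smul_mulVec, dotProduct_smul, smul_eq_mul, mul_left_comm]

theorem quadForm_neg (P : Matrix (Fin n) (Fin n) ℝ) (x : Fin n → ℝ) :
    quadForm (-P) x = -quadForm P x := by
  simp only [quadForm, Matrix.neg_mulVec, dotProduct_neg, mul_neg]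

theorem quadForm_sum {ι : Type*} (s : Finset ι) (P : ι → Matrix (Fin n) (Fin n) ℝ)
    (x : Fin n → ℝ) : quadForm (∑ i ∈ s, P i) x = ∑ i ∈ s, quadForm (P i) x := by
  simp only [quadForm, Matrix.sum_mulVec, dotProduct_sum, Finset.mul_sum]

theorem quadForm_one (x : Fin n → ℝ) :
    quadForm (1 : Matrix (Fin n) (Fin n) ℝ) x = (1 / 2) * (x ⬝ᵥ x) := by
  simp only [quadForm, Matrix.one_mulVec]

theorem quadForm_one_nonneg (x : Fin n → ℝ) :
    0 ≤ quadForm (1 : Matrix (Fin n) (Fin n) ℝ) x := by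
  simpa [quadForm_one] using dotProduct_self_nonneg_real x

theorem quadForm_mul_mul {P : Matrix (Fin n) (Fin n) ℝ} (hP : P.IsSymm)
    (S : Matrix (Fin n) (Fin n) ℝ) (x : Fin n → ℝ) :
    quadForm (P * S * P) x = quadForm S (P *ᵥ x) := by
  rw [quadForm, quadForm, ← Matrix.mulVec_mulVec, ← Matrix.mulVec_mulVec,
    dotProduct_mulVec_comm_of_isSymm hP]

theorem quadForm_riccati {A D S P : Matrix (Fin n) (Fin n) ℝ} (hP : P.IsSymm) (x : Fin n → ℝ) :
    quadForm (riccati A D S P) x =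
      (P *ᵥ x) ⬝ᵥ (A *ᵥ x) + quadForm S (P *ᵥ x) + quadForm D x := by
  have hA : quadForm (Aᵀ * P) x = (1 / 2) * ((P *ᵥ x) ⬝ᵥ (A *ᵥ x)) := by
    rw [quadForm, ← Matrix.mulVec_mulVec, dotProduct_mulVec_eq_transpose,
      Matrix.transpose_transpose, dotProduct_comm]
  have hA' : quadForm (P * A) x = (1 / 2) * ((P *ᵥ x) ⬝ᵥ (A *ᵥ x)) := by
    rw [quadForm, ← Matrix.mulVec_mulVec, dotProduct_mulVec_comm_of_isSymm hP]
  rw [riccati, quadForm_add, quadForm_add, quadForm_add, hA, hA', quadForm_mul_mul hP]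
  ring

/-- The defect of homogeneity of the Riccati operator is governed by the sign of `D - rRSR`. -/
theorem quadForm_riccati_smul {A D S R : Matrix (Fin n) (Fin n) ℝ} (r : ℝ) (x : Fin n → ℝ) :
    quadForm (riccati A D S (r • R)) x =
      r * quadForm (riccati A D S R) x +
        (1 - r) * (quadForm D x - r * quadForm (R * S * R) x) := by
  simp only [riccati, quadForm_add, quadForm_smul, Matrix.mul_smul, Matrix.smul_mul]
  ring

theorem isSymm_riccati {A D S P : Matrix (Fin n) (Fin n) ℝ} (hD : D.IsSymm) (hS : S.IsSymm)
    (hP : P.IsSymm) : (riccati A D S P).IsSymm := by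
  simp only [riccati, Matrix.IsSymm, Matrix.transpose_add, Matrix.transpose_mul,
    Matrix.transpose_transpose, hD.eq, hS.eq, hP.eq, Matrix.mul_assoc]
  abel

theorem riccati_add_sub (A D S P E : Matrix (Fin n) (Fin n) ℝ) :
    riccati A D S (P + E) - riccati A D S P - E * S * E =
      Aᵀ * E + E * A + P * S * E + E * S * P := by
  simp only [riccati]
  noncomm_ring

theorem mem_loewnerInterval_iff {a b : ℝ} {P : Matrix (Fin n) (Fin n) ℝ} :
    P ∈ loewnerInterval n a b ↔ P.IsSymm ∧
      ∀ x, a * quadForm 1 x ≤ quadForm P x ∧ quadForm P x ≤ b * quadForm 1 x := by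
  have hsymm (c : ℝ) : (c • (1 : Matrix (Fin n) (Fin n) ℝ)).IsSymm := Matrix.isSymm_one.smul c
  have hform (Q : Matrix (Fin n) (Fin n) ℝ) (x : Fin n → ℝ) :
      0 ≤ star x ⬝ᵥ (Q *ᵥ x) ↔ 0 ≤ quadForm Q x := by
    simp [quadForm]
  have hherm (Q : Matrix (Fin n) (Fin n) ℝ) : Q.IsHermitian ↔ Q.IsSymm := by
    rw [Matrix.IsHermitian, Matrix.conjTranspose_eq_transpose_of_trivial, Matrix.IsSymm]
  simp only [loewnerInterval, Set.mem_ofPred_eq, Matrix.posSemidef_iff_dotProduct_mulVec, hform,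
    hherm, quadForm_sub, quadForm_smul, sub_nonneg]
  constructor
  · rintro ⟨⟨hP, hlower⟩, -, hupper⟩
    exact ⟨by simpa using hP.add (hsymm a), fun x => ⟨hlower x, hupper x⟩⟩
  · rintro ⟨hP, hbounds⟩
    exact ⟨⟨hP.sub (hsymm a), fun x => (hbounds x).1⟩, (hsymm b).sub hP, fun x => (hbounds x).2⟩

theorem loewnerInterval_subset {a b a' b' : ℝ} (ha : a' ≤ a) (hb : b ≤ b') :
    loewnerInterval n a b ⊆ loewnerInterval n a' b' := by
  intro P hP
  obtain ⟨hP, hbounds⟩ := mem_loewnerInterval_iff.1 hP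
  refine mem_loewnerInterval_iff.2 ⟨hP, fun x => ?_⟩
  have hx := quadForm_one_nonneg x
  exact ⟨(mul_le_mul_of_nonneg_right ha hx).trans (hbounds x).1,
    (hbounds x).2.trans (mul_le_mul_of_nonneg_right hb hx)⟩

end Matrices

section OperatorNorm

open scoped Matrix.Norms.L2Operator

variable {n k : ℕ}

theorem dotProduct_self_eq_norm_sq (x : Fin n → ℝ) : x ⬝ᵥ x = ‖WithLp.toLp 2 x‖ ^ 2 := by
  rw [← real_inner_self_eq_norm_sq, EuclideanSpace.inner_eq_star_dotProduct, star_trivial]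

theorem mulVec_dotProduct_self_le (B : Matrix (Fin n) (Fin k) ℝ) (x : Fin k → ℝ) :
    (B *ᵥ x) ⬝ᵥ (B *ᵥ x) ≤ ‖B‖ ^ 2 * (x ⬝ᵥ x) := by
  rw [dotProduct_self_eq_norm_sq, dotProduct_self_eq_norm_sq, ← mul_pow]
  exact pow_le_pow_left₀ (norm_nonneg _) (B.l2_opNorm_mulVec (WithLp.toLp 2 x)) 2

theorem l2_opNorm_le_of_mulVec_dotProduct_self_le {B : Matrix (Fin n) (Fin k) ℝ} {c : ℝ}
    (hc : 0 ≤ c) (h : ∀ x, (B *ᵥ x) ⬝ᵥ (B *ᵥ x) ≤ c ^ 2 * (x ⬝ᵥ x)) : ‖B‖ ≤ c := by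
  rw [Matrix.l2_opNorm_def]
  refine ContinuousLinearMap.opNorm_le_bound _ hc fun x => ?_
  refine le_of_sq_le_sq ?_ (by positivity)
  have hx := h x.ofLp
  rwa [dotProduct_self_eq_norm_sq, dotProduct_self_eq_norm_sq, ← mul_pow] at hx

theorem l2_opNorm_transpose (B : Matrix (Fin n) (Fin k) ℝ) : ‖Bᵀ‖ = ‖B‖ := by
  rw [← Matrix.conjTranspose_eq_transpose_of_trivial, Matrix.l2_opNorm_conjTranspose]

theorem l2_opNorm_one_le : ‖(1 : Matrix (Fin n) (Fin n) ℝ)‖ ≤ 1 :=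
  l2_opNorm_le_of_mulVec_dotProduct_self_le zero_le_one (by simp)

theorem abs_quadForm_le (B : Matrix (Fin n) (Fin n) ℝ) (x : Fin n → ℝ) :
    |quadForm B x| ≤ ‖B‖ * quadForm 1 x := by
  have hinner : x ⬝ᵥ (B *ᵥ x) = inner ℝ (WithLp.toLp 2 (B *ᵥ x)) (WithLp.toLp 2 x) := by
    rw [EuclideanSpace.inner_eq_star_dotProduct, star_trivial]
  have hbound : |x ⬝ᵥ (B *ᵥ x)| ≤ ‖B‖ * (x ⬝ᵥ x) :=
    calc |x ⬝ᵥ (B *ᵥ x)| ≤ ‖WithLp.toLp 2 (B *ᵥ x)‖ * ‖WithLp.toLp 2 x‖ :=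
          hinner ▸ abs_real_inner_le_norm _ _
      _ ≤ (‖B‖ * ‖WithLp.toLp 2 x‖) * ‖WithLp.toLp 2 x‖ := by
          gcongr
          exact B.l2_opNorm_mulVec (WithLp.toLp 2 x)
      _ = ‖B‖ * (x ⬝ᵥ x) := by rw [dotProduct_self_eq_norm_sq]; ring
  rw [quadForm, quadForm_one, abs_mul, abs_of_pos one_half_pos]
  linarith

/-- Test `0 ≤ P` on `x - ρ⁻¹ P x` and `P ≤ ρ I` on `P x`. -/
theorem l2_opNorm_le_of_mem_loewnerInterval {P : Matrix (Fin n) (Fin n) ℝ} {ρ : ℝ}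
    (hP : P ∈ loewnerInterval n 0 ρ) (hρ : 0 < ρ) : ‖P‖ ≤ ρ := by
  obtain ⟨hsymm, hbounds⟩ := mem_loewnerInterval_iff.1 hP
  simp only [quadForm, Matrix.one_mulVec, zero_mul] at hbounds
  refine l2_opNorm_le_of_mulVec_dotProduct_self_le hρ.le fun x => ?_
  have htest := (hbounds (ρ • x - P *ᵥ x)).1
  have hPx := (hbounds (P *ᵥ x)).2
  have hx := (hbounds x).2
  rw [Matrix.mulVec_sub, Matrix.mulVec_smul, sub_dotProduct, dotProduct_sub, dotProduct_sub,
    smul_dotProduct, dotProduct_smul, smul_dotProduct, dotProduct_smul,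
    dotProduct_mulVec_comm_of_isSymm hsymm x (P *ᵥ x)] at htest
  simp only [smul_eq_mul] at htest
  have hsq : ρ * ((P *ᵥ x) ⬝ᵥ (P *ᵥ x)) ≤ ρ * (ρ * (x ⬝ᵥ (P *ᵥ x))) := by linarith
  have := le_of_mul_le_mul_left hsq hρ
  nlinarith

theorem l2_opNorm_mul_mul_le {P S Q : Matrix (Fin n) (Fin n) ℝ} {a s b : ℝ} (hP : ‖P‖ ≤ a)
    (hS : ‖S‖ ≤ s) (hQ : ‖Q‖ ≤ b) : ‖P * S * Q‖ ≤ a * s * b := by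
  have ha := (norm_nonneg P).trans hP
  have hs := (norm_nonneg S).trans hS
  grw [norm_mul_le, norm_mul_le, hP, hS, hQ]

theorem norm_riccati_le {A D S P : Matrix (Fin n) (Fin n) ℝ} {a d s ρ : ℝ} (hA : ‖A‖ ≤ a)
    (hD : ‖D‖ ≤ d) (hS : ‖S‖ ≤ s) (hP : ‖P‖ ≤ ρ) :
    ‖riccati A D S P‖ ≤ 2 * a * ρ + ρ * s * ρ + d := by
  have ha := (norm_nonneg A).trans hA
  have _ := (norm_nonneg P).trans hP
  have hAP : ‖Aᵀ * P‖ ≤ a * ρ := by grw [norm_mul_le, l2_opNorm_transpose, hA, hP]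
  have hPA : ‖P * A‖ ≤ ρ * a := by grw [norm_mul_le, hA, hP]
  have hPSP := l2_opNorm_mul_mul_le hP hS hP
  unfold riccati
  grw [norm_add_le, norm_add₃_le, hAP, hPA, hPSP, hD]
  linarith

theorem quadForm_riccati_sub_le {A D S P Q : Matrix (Fin n) (Fin n) ℝ} {a s ρ η : ℝ}
    (hA : ‖A‖ ≤ a) (hS : ‖S‖ ≤ s) (hP : ‖P‖ ≤ ρ) (hQ : ‖Q - P‖ ≤ η) (y : Fin n → ℝ) :
    quadForm (riccati A D S Q) y - quadForm (riccati A D S P) y ≤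
      (2 * (a + ρ * s) * η + η * s * η) * quadForm 1 y ∧
    quadForm (riccati A D S P) y - quadForm (riccati A D S Q - (Q - P) * S * (Q - P)) y ≤
      2 * (a + ρ * s) * η * quadForm 1 y := by
  obtain ⟨E, rfl⟩ : ∃ E, Q = P + E := ⟨Q - P, (add_sub_cancel P Q).symm⟩
  rw [add_sub_cancel_left] at hQ ⊢
  have ha := (norm_nonneg A).trans hA
  have hAE : ‖Aᵀ * E‖ ≤ a * η := by grw [norm_mul_le, l2_opNorm_transpose, hA, hQ]
  have hEA : ‖E * A‖ ≤ η * a := by grw [norm_mul_le, hA, hQ]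
  have hlin : ‖riccati A D S (P + E) - riccati A D S P - E * S * E‖ ≤ 2 * (a + ρ * s) * η := by
    rw [riccati_add_sub]
    grw [norm_add_le, norm_add₃_le, hAE, hEA, l2_opNorm_mul_mul_le hP hS hQ,
      l2_opNorm_mul_mul_le hQ hS hP]
    linarith
  have hone := quadForm_one_nonneg y
  have hylin := (abs_quadForm_le _ y).trans (mul_le_mul_of_nonneg_right hlin hone)
  have hyquad := (abs_quadForm_le (E * S * E) y).trans
    (mul_le_mul_of_nonneg_right (l2_opNorm_mul_mul_le hQ hS hQ) hone)
  simp only [quadForm_sub, abs_le] at hylin hyquad ⊢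
  constructor <;> linarith

end OperatorNorm

/-! ### Counting arithmetic operations -/

/-- With `c` more operations, any straight-line program which provides the values in `B` provides
the values in `T`. -/
def Obtains {X : Type} (B : Set (X → ℝ)) (c : ℕ) (T : Set (X → ℝ)) : Prop :=
  ∀ ⦃I : Set (X → ℝ)⦄ ⦃t : ℕ⦄ ⦃G : Set (X → ℝ)⦄, StraightLine I t G → B ⊆ G →
    ∃ G', G ⊆ G' ∧ T ⊆ G' ∧ StraightLine I (t + c) G'

namespace Obtains

variable {X : Type} {B B' T T' : Set (X → ℝ)} {c c' : ℕ} {f g : X → ℝ}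

theorem of_subset (h : T ⊆ B) : Obtains B 0 T := fun _ _ G hG hB =>
  ⟨G, subset_rfl, h.trans hB, hG⟩

theorem mono (h : Obtains B c T) (hB : B ⊆ B') (hT : T' ⊆ T) : Obtains B' c T' := by
  intro I t G hG hBG
  obtain ⟨G', hGG', hTG', hG'⟩ := h hG (hB.trans hBG)
  exact ⟨G', hGG', hT.trans hTG', hG'⟩

theorem union (h : Obtains B c T) (h' : Obtains (B ∪ T) c' T') :
    Obtains B (c + c') (T ∪ T') := by
  intro I t G hG hB
  obtain ⟨G₁, hGG₁, hTG₁, hG₁⟩ := h hG hB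
  obtain ⟨G₂, hG₁G₂, hT'G₂, hG₂⟩ := h' hG₁ (Set.union_subset (hB.trans hGG₁) hTG₁)
  exact ⟨G₂, hGG₁.trans hG₁G₂, Set.union_subset (hTG₁.trans hG₁G₂) hT'G₂, by
    rwa [← add_assoc]⟩

theorem bind (h : Obtains B c T) (h' : ∀ B', B ⊆ B' → T ⊆ B' → Obtains B' c' T') :
    Obtains B (c + c') T' :=
  (h.union (h' _ Set.subset_union_left Set.subset_union_right)).mono subset_rfl
    Set.subset_union_right

theorem add (hf : f ∈ B) (hg : g ∈ B) : Obtains B 1 {fun x => f x + g x} :=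
  fun _ _ _ hG hB => ⟨_, Set.subset_insert _ _, by simp, hG.add (hB hf) (hB hg)⟩

theorem mul (hf : f ∈ B) (hg : g ∈ B) : Obtains B 1 {fun x => f x * g x} :=
  fun _ _ _ hG hB => ⟨_, Set.subset_insert _ _, by simp, hG.mul (hB hf) (hB hg)⟩

theorem biUnion {ι : Type*} (s : Finset ι) {T : ι → Set (X → ℝ)}
    (h : ∀ i ∈ s, Obtains B c (T i)) : Obtains B (s.card * c) (⋃ i ∈ s, T i) := by
  classical
  induction s using Finset.induction_on with
  | empty => simpa using (of_subset (Set.empty_subset B))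
  | insert a s ha ih =>
    rw [Finset.card_insert_of_notMem ha, add_mul, one_mul, Finset.set_biUnion_insert,
      Set.union_comm]
    exact (ih fun i hi => h i (Finset.mem_insert_of_mem hi)).union
      ((h a (Finset.mem_insert_self a s)).mono Set.subset_union_left subset_rfl)

theorem iUnion {ι : Type*} [Fintype ι] {T : ι → Set (X → ℝ)} (h : ∀ i, Obtains B c (T i)) :
    Obtains B (Fintype.card ι * c) (⋃ i, T i) := by
  simpa using biUnion Finset.univ fun i _ => h i

theorem sum_mul {n : ℕ} {f g : Fin n → X → ℝ} (hzero : (fun _ => 0) ∈ B) (hf : ∀ j, f j ∈ B)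
    (hg : ∀ j, g j ∈ B) : Obtains B (2 * n) {fun x => ∑ j, f j x * g j x} := by
  induction n with
  | zero => exact of_subset (by simpa using hzero)
  | succ n ih =>
    simp only [Fin.sum_univ_castSucc]
    have hinit := ih (f := fun j => f j.castSucc) (g := fun j => g j.castSucc)
      (fun j => hf _) (fun j => hg _)
    have hlast := (mul (hf (Fin.last n)) (hg (Fin.last n))).mono
      (Set.subset_union_left (t := {fun x => ∑ j : Fin n, f j.castSucc x * g j.castSucc x}))
      subset_rfl
    exact (hinit.union hlast).bind fun B' _ hterms =>
      add (f := fun x => ∑ j : Fin n, f j.castSucc x * g j.castSucc x) (hterms (by simp))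
        (hterms (by simp))

end Obtains

/-- The set of the entries of a matrix which depends on the input. -/
def entrySet {X : Type} {n : ℕ} (F : X → Matrix (Fin n) (Fin n) ℝ) : Set (X → ℝ) :=
  ⋃ ij : Fin n × Fin n, {fun x => F x ij.1 ij.2}

theorem entrySet_subset_iff {X : Type} {n : ℕ} {F : X → Matrix (Fin n) (Fin n) ℝ}
    {B : Set (X → ℝ)} : entrySet F ⊆ B ↔ ∀ i j, (fun x => F x i j) ∈ B := by
  simp [entrySet, Set.range_subset_iff]

namespace Obtains

variable {X : Type} {n c c' : ℕ} {B : Set (X → ℝ)} {F G : X → Matrix (Fin n) (Fin n) ℝ}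

theorem entrySet_of_forall (h : ∀ i j, Obtains B c {fun x => F x i j}) :
    Obtains B (n ^ 2 * c) (entrySet F) := by
  have hunion := iUnion fun ij : Fin n × Fin n => h ij.1 ij.2
  rwa [Fintype.card_prod, Fintype.card_fin, ← sq] at hunion

theorem matrix_mul (hzero : (fun _ => 0) ∈ B) (hF : Obtains B c (entrySet F))
    (hG : Obtains B c' (entrySet G)) :
    Obtains B (c + c' + 2 * n ^ 3) (entrySet fun x => F x * G x) := by
  refine (hF.union (hG.mono Set.subset_union_left subset_rfl)).bind fun B' hB' hFG => ?_
  simp only [Set.union_subset_iff, entrySet_subset_iff] at hFG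
  rw [show 2 * n ^ 3 = n ^ 2 * (2 * n) by ring]
  exact entrySet_of_forall fun i j => by
    simpa only [Matrix.mul_apply] using
      sum_mul (hB' hzero) (fun l => hFG.1 i l) fun l => hFG.2 l j

theorem matrix_add (hF : Obtains B c (entrySet F)) (hG : Obtains B c' (entrySet G)) :
    Obtains B (c + c' + n ^ 2) (entrySet fun x => F x + G x) := by
  refine (hF.union (hG.mono Set.subset_union_left subset_rfl)).bind fun B' _ hFG => ?_
  simp only [Set.union_subset_iff, entrySet_subset_iff] at hFG
  simpa only [mul_one, Matrix.add_apply] using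
    entrySet_of_forall (F := fun x => F x + G x) fun i j => add (hFG.1 i j) (hFG.2 i j)

theorem matrix_smul {f : X → ℝ} (hf : f ∈ B) (hG : Obtains B c (entrySet G)) :
    Obtains B (c + n ^ 2) (entrySet fun x => f x • G x) := by
  refine hG.bind fun B' hB' hGB' => ?_
  rw [entrySet_subset_iff] at hGB'
  simpa only [mul_one, Matrix.smul_apply, smul_eq_mul] using
    entrySet_of_forall (F := fun x => f x • G x) fun i j => mul (hB' hf) (hGB' i j)

end Obtains

namespace MethodInput

variable {n M : ℕ}

/-- One step of the explicit Euler scheme for the Riccati equation of index `m`. -/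
def euler (X : MethodInput n M) (R : Matrix (Fin n) (Fin n) ℝ) (m : Fin M) :
    Matrix (Fin n) (Fin n) ℝ :=
  R + X.τ • riccati (X.A m) (X.D m) (X.S m) R

/-- The Euler scheme along a word, started from the initial matrix of the input. -/
def eulerWord {N : ℕ} (i : Fin N → Fin M) (X : MethodInput n M) : Matrix (Fin n) (Fin n) ℝ :=
  (List.ofFn i).foldl X.euler X.P

theorem eulerWord_zero (i : Fin 0 → Fin M) (X : MethodInput n M) : eulerWord i X = X.P := by
  simp [eulerWord]

theorem eulerWord_succ {N : ℕ} (i : Fin (N + 1) → Fin M) (X : MethodInput n M) :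
    eulerWord i X = X.euler (eulerWord (fun j => i j.castSucc) X) (i (Fin.last N)) := by
  rw [eulerWord, List.ofFn_succ', List.concat_eq_append, List.foldl_append]
  rfl

theorem obtains_euler {B : Set (MethodInput n M → ℝ)} (hB : initialValues n M ⊆ B)
    {R : MethodInput n M → Matrix (Fin n) (Fin n) ℝ} (hR : entrySet R ⊆ B) (m : Fin M) :
    Obtains B (8 * n ^ 3 + 5 * n ^ 2) (entrySet fun X => X.euler (R X) m) := by
  have hzero : (fun _ => 0) ∈ B := hB (.inl ⟨0, by simp⟩)
  have hτ : (fun X : MethodInput n M => X.τ) ∈ B := hB (by simp [initialValues])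
  have hA : Obtains B 0 (entrySet fun X : MethodInput n M => X.A m) :=
    .of_subset <| entrySet_subset_iff.2 fun i j => hB (.inr (.inl ⟨m, i, j, rfl⟩))
  have hAt : Obtains B 0 (entrySet fun X : MethodInput n M => (X.A m)ᵀ) :=
    .of_subset <| entrySet_subset_iff.2 fun i j => hB (.inr (.inl ⟨m, j, i, rfl⟩))
  have hD : Obtains B 0 (entrySet fun X : MethodInput n M => X.D m) :=
    .of_subset <| entrySet_subset_iff.2 fun i j => hB (.inr (.inr (.inl ⟨m, i, j, rfl⟩)))
  have hS : Obtains B 0 (entrySet fun X : MethodInput n M => X.S m) :=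
    .of_subset <| entrySet_subset_iff.2 fun i j => hB (.inr (.inr (.inr (.inl ⟨m, i, j, rfl⟩))))
  have hR : Obtains B 0 (entrySet R) := .of_subset hR
  have hlinear := (hAt.matrix_mul hzero hR).matrix_add (hR.matrix_mul hzero hA)
  have hquadratic := (hR.matrix_mul hzero hS).matrix_mul hzero hR
  have hriccati := (hlinear.matrix_add hquadratic).matrix_add hD
  simp only [euler, riccati]
  convert hR.matrix_add (hriccati.matrix_smul hτ) using 1
  ring

/-- The number of operations of the Euler scheme along all words of length `N`. -/
def eulerCost (n M N : ℕ) : ℕ :=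
  ∑ j ∈ Finset.range N, M ^ (j + 1) * (8 * n ^ 3 + 5 * n ^ 2)

theorem obtains_eulerWord (n M N : ℕ) :
    Obtains (initialValues n M) (eulerCost n M N)
      (⋃ i : Fin N → Fin M, entrySet (eulerWord (n := n) i)) := by
  induction N with
  | zero =>
    refine .of_subset (Set.iUnion_subset fun i => entrySet_subset_iff.2 fun a b => ?_)
    simp only [eulerWord_zero]
    exact .inr (.inr (.inr (.inr (.inr ⟨a, b, rfl⟩))))
  | succ N ih =>
    rw [eulerCost, Finset.sum_range_succ]
    refine ih.bind fun B hB hwords => ?_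
    have hstep (i : Fin (N + 1) → Fin M) :
        Obtains B (8 * n ^ 3 + 5 * n ^ 2) (entrySet (eulerWord (n := n) i)) := by
      simpa only [← eulerWord_succ] using
        obtains_euler hB ((Set.subset_iUnion _ fun j => i j.castSucc).trans hwords) (i (Fin.last N))
    simpa only [Fintype.card_fun, Fintype.card_fin] using Obtains.iUnion hstep

theorem computedWith_eulerWord (n M N : ℕ) :
    ComputedWith (fun i : Fin N → Fin M => eulerWord (n := n) i) (eulerCost n M N) := by
  obtain ⟨G, -, hwords, hG⟩ := obtains_eulerWord n M N .start subset_rfl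
  rw [zero_add] at hG
  exact ⟨G, hG, fun i => entrySet_subset_iff.1 ((Set.subset_iUnion _ i).trans hwords)⟩

theorem eulerCost_le {M : ℕ} (hM : 2 ≤ M) (n N : ℕ) :
    eulerCost n M N ≤ 26 * M ^ N * n ^ 3 := by
  have hgeom : ∑ j ∈ Finset.range N, M ^ (j + 1) ≤ 2 * M ^ N := by
    induction N with
    | zero => simp
    | succ N ih =>
      rw [Finset.sum_range_succ, pow_succ']
      have hdouble : 2 * M ^ N ≤ M * M ^ N := Nat.mul_le_mul_right _ hM
      omega
  have hsq : n ^ 2 ≤ n ^ 3 := by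
    rcases n.eq_zero_or_pos with rfl | hn
    · simp
    · exact Nat.pow_le_pow_right hn (by norm_num)
  rw [eulerCost, ← Finset.sum_mul]
  calc _ ≤ 2 * M ^ N * (13 * n ^ 3) := Nat.mul_le_mul hgeom (by omega)
    _ = _ := by ring

theorem eulerCost_le_rpow {M : ℕ} (hM : 2 ≤ M) (n : ℕ) {N : ℕ} {s : ℝ} (hN : N ≤ s) :
    (eulerCost n M N : ℝ) ≤ 26 * (M : ℝ) ^ s * (n : ℝ) ^ 3 := by
  have hpow : (M : ℝ) ^ N ≤ (M : ℝ) ^ s := by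
    rw [← Real.rpow_natCast]
    exact Real.rpow_le_rpow_of_exponent_le (by exact_mod_cast one_le_two.trans hM) hN
  calc (eulerCost n M N : ℝ) ≤ 26 * (M : ℝ) ^ N * (n : ℝ) ^ 3 := by
        exact_mod_cast eulerCost_le hM n N
    _ ≤ 26 * (M : ℝ) ^ s * (n : ℝ) ^ 3 := by gcongr

end MethodInput

namespace ApproxWithin

variable {n : ℕ} {ε : ℝ}

theorem symm {F G : (Fin n → ℝ) → EReal} (h : ApproxWithin ε F G) : ApproxWithin ε G F := by
  intro x
  obtain ⟨a, b, ha, hb, hab⟩ := h x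
  exact ⟨b, a, hb, ha, abs_sub_comm a b ▸ hab⟩

theorem of_coe_le_of_le_coe {F : (Fin n → ℝ) → EReal} {f l u : (Fin n → ℝ) → ℝ}
    (hlF : ∀ x, (l x : EReal) ≤ F x) (hFu : ∀ x, F x ≤ u x)
    (hfl : ∀ x, f x ≤ l x + ε * (x ⬝ᵥ x)) (huf : ∀ x, u x ≤ f x + ε * (x ⬝ᵥ x)) :
    ApproxWithin ε (fun x => (f x : EReal)) F := by
  intro x
  lift F x to ℝ using ⟨ne_top_of_le_ne_top (EReal.coe_ne_top _) (hFu x),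
    ne_bot_of_le_ne_bot (EReal.coe_ne_bot _) (hlF x)⟩ with r hr
  have hl : l x ≤ r := by simpa only [← hr, EReal.coe_le_coe_iff] using hlF x
  have hu : r ≤ u x := by simpa only [← hr, EReal.coe_le_coe_iff] using hFu x
  exact ⟨f x, r, rfl, rfl, abs_le.2 ⟨by linarith [huf x], by linarith [hfl x]⟩⟩

end ApproxWithin

namespace SwitchingLQ

variable {n k M : ℕ}

/-! ### Trajectories -/

/-- The quadruple `(T, w, μ, ξ)` competes in the definition of the value function at `x`. -/
structure IsAdmissible (p : SwitchingLQ n k M) (x : Fin n → ℝ) (T : ℝ) (w : ℝ → Fin k → ℝ)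
    (μ : ℝ → Fin M) (ξ : ℝ → Fin n → ℝ) : Prop where
  isDisturbance : IsDisturbance w
  measurable : Measurable μ
  isTrajectory : p.IsTrajectory x T w μ ξ

theorem intervalIntegrable_comp_index {μ : ℝ → Fin M} (hμ : Measurable μ) (F : Fin M → ℝ)
    (a b : ℝ) : IntervalIntegrable (fun t => F (μ t)) volume a b := by
  have hmeas : Measurable fun t => F (μ t) := (measurable_of_finite F).comp hμ
  exact (intervalIntegrable_const (c := ‖F‖)).mono_fun hmeas.aestronglyMeasurable
    (.of_forall fun t => (norm_le_pi_norm F (μ t)).trans (le_abs_self _))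

theorem IsDisturbance.intervalIntegrable_dotProduct_self {w : ℝ → Fin k → ℝ}
    (hw : IsDisturbance w) {T : ℝ} (hT : 0 ≤ T) :
    IntervalIntegrable (fun t => w t ⬝ᵥ w t) volume 0 T :=
  (intervalIntegrable_iff_integrableOn_Icc_of_le hT).2 (hw T).2

theorem IsDisturbance.intervalIntegrable_apply {w : ℝ → Fin k → ℝ} (hw : IsDisturbance w) {T : ℝ}
    (hT : 0 ≤ T) (l : Fin k) : IntervalIntegrable (fun t => w t l) volume 0 T := by
  rw [intervalIntegrable_iff_integrableOn_Icc_of_le hT]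
  have hdom : IntegrableOn (fun t => 1 + w t ⬝ᵥ w t) (Set.Icc 0 T) :=
    (integrableOn_const (by simp)).add (hw T).2
  refine hdom.mono' ((continuous_apply l).comp_aestronglyMeasurable (hw T).1)
    (.of_forall fun t => ?_)
  have hl : w t l * w t l ≤ w t ⬝ᵥ w t :=
    Finset.single_le_sum (f := fun i => w t i * w t i) (fun i _ => mul_self_nonneg _)
      (Finset.mem_univ l)
  rw [Real.norm_eq_abs, abs_le]
  constructor <;> nlinarith [sq_nonneg (w t l - 1), sq_nonneg (w t l + 1)]

theorem intervalIntegrable_drift (p : SwitchingLQ n k M) {T : ℝ} (hT : 0 ≤ T)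
    {w : ℝ → Fin k → ℝ} (hw : IsDisturbance w) {μ : ℝ → Fin M} (hμ : Measurable μ)
    {ξ : ℝ → Fin n → ℝ} (hξ : ContinuousOn ξ (Set.Icc 0 T)) :
    IntervalIntegrable (fun s => p.A (μ s) *ᵥ ξ s + p.sig (μ s) *ᵥ w s) volume 0 T := by
  have hAξ (i j : Fin n) : IntervalIntegrable (fun s => p.A (μ s) i j * ξ s j) volume 0 T :=
    (intervalIntegrable_comp_index hμ (fun m => p.A m i j) 0 T).mul_continuousOn
      ((continuous_apply j).comp_continuousOn (Set.uIcc_of_le hT ▸ hξ))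
  have hsigw (i : Fin n) (l : Fin k) :
      IntervalIntegrable (fun s => p.sig (μ s) i l * w s l) volume 0 T := by
    have hmeas : Measurable fun s => p.sig (μ s) i l :=
      (measurable_of_finite fun m => p.sig m i l).comp hμ
    rw [intervalIntegrable_iff]
    exact (intervalIntegrable_iff.1 (hw.intervalIntegrable_apply hT l)).bdd_mul
      (c := ‖fun m => p.sig m i l‖) hmeas.aestronglyMeasurable
      (.of_forall fun t => norm_le_pi_norm (fun m => p.sig m i l) (μ t))
  rw [intervalIntegrable_iff]
  refine Integrable.of_eval fun i => ?_
  simp only [Pi.add_apply, Matrix.mulVec, dotProduct]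
  exact (integrable_finsetSum _ fun j _ => intervalIntegrable_iff.1 (hAξ i j)).add
    (integrable_finsetSum _ fun l _ => intervalIntegrable_iff.1 (hsigw i l))

theorem intervalIntegrable_payoff (p : SwitchingLQ n k M) {T : ℝ} (hT : 0 ≤ T)
    {w : ℝ → Fin k → ℝ} (hw : IsDisturbance w) {μ : ℝ → Fin M} (hμ : Measurable μ)
    {ξ : ℝ → Fin n → ℝ} (hξ : ContinuousOn ξ (Set.Icc 0 T)) :
    IntervalIntegrable (fun t => (1 / 2) * (ξ t ⬝ᵥ (p.D (μ t) *ᵥ ξ t)) -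
      p.γ ^ 2 / 2 * (w t ⬝ᵥ w t)) volume 0 T := by
  have hξj (j : Fin n) : ContinuousOn (fun t => ξ t j) (Set.uIcc 0 T) :=
    (continuous_apply j).comp_continuousOn (Set.uIcc_of_le hT ▸ hξ)
  have hDξ (i j : Fin n) :
      IntervalIntegrable (fun s => ξ s i * (p.D (μ s) i j * ξ s j)) volume 0 T :=
    ((intervalIntegrable_comp_index hμ (fun m => p.D m i j) 0 T).mul_continuousOn
      (hξj j)).continuousOn_mul (hξj i)
  refine IntervalIntegrable.sub (.const_mul ?_ _)
    ((hw.intervalIntegrable_dotProduct_self hT).const_mul _)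
  simp only [Matrix.mulVec, dotProduct, Finset.mul_sum, intervalIntegrable_iff] at hDξ ⊢
  exact integrable_finsetSum _ fun i _ => integrable_finsetSum _ fun j _ => hDξ i j

theorem IsTrajectory.apply_zero {p : SwitchingLQ n k M} {x : Fin n → ℝ} {T : ℝ} (hT : 0 ≤ T)
    {w : ℝ → Fin k → ℝ} {μ : ℝ → Fin M}
    {ξ : ℝ → Fin n → ℝ} (h : p.IsTrajectory x T w μ ξ) : ξ 0 = x := by
  simpa using h.2 0 ⟨le_rfl, hT⟩

theorem isDisturbance_of_continuous {w : ℝ → Fin k → ℝ} (hw : Continuous w) :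
    IsDisturbance w := fun _ =>
  ⟨hw.aestronglyMeasurable, (hw.dotProduct hw).integrableOn_Icc⟩

theorem exists_isTrajectory_feedback (p : SwitchingLQ n k M) (m : Fin M)
    (G : Matrix (Fin k) (Fin n) ℝ) (x : Fin n → ℝ) :
    ∃ ξ : ℝ → Fin n → ℝ, IsDisturbance (fun t => G *ᵥ ξ t) ∧
      ∀ T, p.IsTrajectory x T (fun t => G *ᵥ ξ t) (fun _ => m) ξ := by
  let B : (Fin n → ℝ) →L[ℝ] (Fin n → ℝ) :=
    (Matrix.mulVecLin (p.A m + p.sig m * G)).toContinuousLinearMap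
  have hB (y : Fin n → ℝ) : B y = p.A m *ᵥ y + p.sig m *ᵥ (G *ᵥ y) := by
    simp [B, Matrix.mulVec_mulVec]
  let ξ : ℝ → Fin n → ℝ := fun t => NormedSpace.exp (t • B) x
  have hderiv (t : ℝ) : HasDerivAt ξ (B (ξ t)) t :=
    (ContinuousLinearMap.apply ℝ (Fin n → ℝ) x).hasFDerivAt.comp_hasDerivAt t
      (hasDerivAt_exp_smul_const' (𝕂 := ℝ) B t)
  have hcont : Continuous ξ := continuous_iff_continuousAt.2 fun t => (hderiv t).continuousAt
  refine ⟨ξ, isDisturbance_of_continuous (continuous_const.matrix_mulVec hcont),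
    fun T => ⟨hcont.continuousOn, fun t _ => ?_⟩⟩
  have hFTC := intervalIntegral.integral_eq_sub_of_hasDerivAt (a := 0) (b := t)
    (fun s _ => hderiv s) ((B.continuous.comp hcont).intervalIntegrable _ _)
  have hξ0 : ξ 0 = x := by simp [ξ]
  simp only [hB, hξ0] at hFTC
  rw [hFTC, add_sub_cancel]

/-! ### The payoff measured against a path of quadratic forms -/

/-- The matrix `Σᵐ = γ⁻² σᵐ (σᵐ)'`. -/
noncomputable def S (p : SwitchingLQ n k M) (m : Fin M) : Matrix (Fin n) (Fin n) ℝ :=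
  (1 / p.γ ^ 2) • (p.sig m * (p.sig m)ᵀ)

/-- The Riccati operator of the index `m`. -/
noncomputable def ric (p : SwitchingLQ n k M) (m : Fin M) (P : Matrix (Fin n) (Fin n) ℝ) :
    Matrix (Fin n) (Fin n) ℝ :=
  riccati (p.A m) (p.D m) (p.S m) P

variable {p : SwitchingLQ n k M}

theorem isSymm_S (p : SwitchingLQ n k M) (m : Fin M) : (p.S m).IsSymm := by
  simp [S, Matrix.IsSymm, Matrix.transpose_smul, Matrix.transpose_mul]

theorem isSymm_ric {m : Fin M} (hD : (p.D m).IsSymm) {P : Matrix (Fin n) (Fin n) ℝ}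
    (hP : P.IsSymm) : (p.ric m P).IsSymm :=
  isSymm_riccati hD (p.isSymm_S m) hP

theorem quadForm_S (p : SwitchingLQ n k M) (m : Fin M) (y : Fin n → ℝ) :
    quadForm (p.S m) y =
      1 / p.γ ^ 2 * ((1 / 2) * (((p.sig m)ᵀ *ᵥ y) ⬝ᵥ ((p.sig m)ᵀ *ᵥ y))) := by
  rw [S, quadForm_smul, quadForm, ← Matrix.mulVec_mulVec, dotProduct_mulVec_eq_transpose]

theorem quadForm_S_nonneg (p : SwitchingLQ n k M) (m : Fin M) (y : Fin n → ℝ) :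
    0 ≤ quadForm (p.S m) y := by
  have := dotProduct_self_nonneg_real ((p.sig m)ᵀ *ᵥ y)
  rw [quadForm_S]
  positivity

/-- Completing the square in the disturbance `w`. -/
theorem payoff_density_eq (hγ : p.γ ≠ 0) (m : Fin M) {P : Matrix (Fin n) (Fin n) ℝ}
    (hP : P.IsSymm) (P' : Matrix (Fin n) (Fin n) ℝ) (x : Fin n → ℝ) (w : Fin k → ℝ) :
    (1 / 2) * ((p.A m *ᵥ x + p.sig m *ᵥ w) ⬝ᵥ (P *ᵥ x) + x ⬝ᵥ (P' *ᵥ x) +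
        x ⬝ᵥ (P *ᵥ (p.A m *ᵥ x + p.sig m *ᵥ w))) +
      ((1 / 2) * (x ⬝ᵥ (p.D m *ᵥ x)) - p.γ ^ 2 / 2 * (w ⬝ᵥ w)) =
    quadForm (P' + p.ric m P) x -
      p.γ ^ 2 / 2 * ((w - (1 / p.γ ^ 2) • ((p.sig m)ᵀ *ᵥ (P *ᵥ x))) ⬝ᵥ
        (w - (1 / p.γ ^ 2) • ((p.sig m)ᵀ *ᵥ (P *ᵥ x)))) := by
  rw [quadForm_add, ric, quadForm_riccati hP, quadForm_S, quadForm, quadForm,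
    dotProduct_mulVec_comm_of_isSymm hP x (_ + _), dotProduct_comm (_ + _) (P *ᵥ x),
    dotProduct_add, dotProduct_mulVec_eq_transpose (p.sig m)]
  set z := (p.sig m)ᵀ *ᵥ (P *ᵥ x)
  rw [sub_dotProduct, dotProduct_sub, dotProduct_sub, dotProduct_smul, smul_dotProduct,
    smul_dotProduct, dotProduct_smul, dotProduct_comm w z]
  simp only [smul_eq_mul]
  field_simp
  ring

/-- The energy balance along a trajectory: the feedback `γ⁻² σ' P(t) ξ` is optimal when `P` solves
the Riccati equation `P' + Ric(P) = 0`. -/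
theorem IsAdmissible.running_add_quadForm {x : Fin n → ℝ} {T : ℝ} {w : ℝ → Fin k → ℝ}
    {μ : ℝ → Fin M} {ξ : ℝ → Fin n → ℝ} (h : p.IsAdmissible x T w μ ξ) (hγ : p.γ ≠ 0)
    (hT : 0 ≤ T) {P P' : ℝ → Matrix (Fin n) (Fin n) ℝ} (hsymm : ∀ t, (P t).IsSymm)
    (hP : ∀ i j, HasACDeriv 0 T (fun t => P t i j) (fun t => P' t i j)) :
    p.running T w μ ξ + quadForm (P T) (ξ T) =
      quadForm (P 0) x + ∫ t in (0 : ℝ)..T, (quadForm (P' t + p.ric (μ t) (P t)) (ξ t) -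
        p.γ ^ 2 / 2 * ((w t - (1 / p.γ ^ 2) • ((p.sig (μ t))ᵀ *ᵥ (P t *ᵥ ξ t))) ⬝ᵥ
          (w t - (1 / p.γ ^ 2) • ((p.sig (μ t))ᵀ *ᵥ (P t *ᵥ ξ t))))) := by
  set v : ℝ → Fin n → ℝ := fun s => p.A (μ s) *ᵥ ξ s + p.sig (μ s) *ᵥ w s with hv
  have hvint := p.intervalIntegrable_drift hT h.isDisturbance h.measurable h.isTrajectory.1
  set ζ : ℝ → Fin n → ℝ := fun t i => x i + ∫ s in (0 : ℝ)..t, v s i with hζ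
  have hξζ : ∀ t ∈ Set.Icc 0 T, ξ t = ζ t := fun t ht => funext fun i => by
    have hvt : IntegrableOn v (Set.Ioc 0 t) :=
      ((intervalIntegrable_iff_integrableOn_Ioc_of_le hT).1 hvint).mono_set
        (Set.Ioc_subset_Ioc_right ht.2)
    rw [h.isTrajectory.2 t ht, hζ, Pi.add_apply, intervalIntegral.integral_of_le ht.1,
      eval_integral fun j => hvt.eval j, ← intervalIntegral.integral_of_le ht.1]
  have hquad := HasACDeriv.dotProduct_mulVec (ξ := ζ) (ξ' := v)
    (fun i => .const_add_integral (x i) ⟨hvint.1.eval i, hvint.2.eval i⟩) hP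
  have hζ0 : ζ 0 = x := by simp [hζ]
  simp only [← payoff_density_eq hγ _ (hsymm _)]
  rw [intervalIntegral.integral_add, intervalIntegral.integral_const_mul, ← running,
    intervalIntegral.integral_congr (g := fun t =>
      v t ⬝ᵥ (P t *ᵥ ζ t) + ζ t ⬝ᵥ (P' t *ᵥ ζ t) + ζ t ⬝ᵥ (P t *ᵥ v t)),
    hquad.integral_eq_sub, hζ0, hξζ T ⟨hT, le_rfl⟩, quadForm, quadForm]
  · ring
  · exact fun t ht => by simp only [hv, hξζ t (Set.uIcc_of_le hT ▸ ht)]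
  · refine (hquad.intervalIntegrable.congr fun t ht => ?_).const_mul _
    simp only [hv, hξζ t (Set.Ioc_subset_Icc_self (Set.uIoc_of_le hT ▸ ht))]
  · exact p.intervalIntegrable_payoff hT h.isDisturbance h.measurable h.isTrajectory.1

theorem IsAdmissible.running_add_quadForm_le {x : Fin n → ℝ} {T : ℝ} {w : ℝ → Fin k → ℝ}
    {μ : ℝ → Fin M} {ξ : ℝ → Fin n → ℝ} (h : p.IsAdmissible x T w μ ξ) (hγ : p.γ ≠ 0)
    (hT : 0 ≤ T) {P P' : ℝ → Matrix (Fin n) (Fin n) ℝ} (hsymm : ∀ t, (P t).IsSymm)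
    (hP : ∀ i j, HasACDeriv 0 T (fun t => P t i j) (fun t => P' t i j))
    (hsup : ∀ t ∈ Set.Icc 0 T, quadForm (P' t + p.ric (μ t) (P t)) (ξ t) ≤ 0) :
    p.running T w μ ξ + quadForm (P T) (ξ T) ≤ quadForm (P 0) x := by
  rw [h.running_add_quadForm hγ hT hsymm hP, add_le_iff_nonpos_right, ← neg_nonneg,
    ← intervalIntegral.integral_neg]
  refine intervalIntegral.integral_nonneg hT fun t ht => ?_
  rw [neg_nonneg]
  exact (sub_le_self _ (mul_nonneg (by positivity) (dotProduct_self_nonneg_real _))).trans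
    (hsup t ht)

/-- The feedback `γ⁻² σ' P̄ ξ` with a constant gain costs only the second order term
`(P - P̄) Σ (P - P̄)`. -/
theorem IsAdmissible.le_running_add_quadForm {x : Fin n → ℝ} {T : ℝ} {μ : ℝ → Fin M}
    {ξ : ℝ → Fin n → ℝ} {Q : Matrix (Fin n) (Fin n) ℝ} {w : ℝ → Fin k → ℝ}
    (h : p.IsAdmissible x T w μ ξ)
    (hw : ∀ t, w t = (1 / p.γ ^ 2) • ((p.sig (μ t))ᵀ *ᵥ (Q *ᵥ ξ t)))
    (hγ : p.γ ≠ 0) (hT : 0 ≤ T) (hQ : Q.IsSymm) {P P' : ℝ → Matrix (Fin n) (Fin n) ℝ}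
    (hsymm : ∀ t, (P t).IsSymm)
    (hP : ∀ i j, HasACDeriv 0 T (fun t => P t i j) (fun t => P' t i j))
    (hsub : ∀ t ∈ Set.Icc 0 T, ∀ y,
      0 ≤ quadForm (P' t + p.ric (μ t) (P t) - (P t - Q) * p.S (μ t) * (P t - Q)) y) :
    quadForm (P 0) x ≤ p.running T w μ ξ + quadForm (P T) (ξ T) := by
  rw [h.running_add_quadForm hγ hT hsymm hP, le_add_iff_nonneg_right]
  refine intervalIntegral.integral_nonneg hT fun t ht => ?_
  have hgain : w t - (1 / p.γ ^ 2) • ((p.sig (μ t))ᵀ *ᵥ (P t *ᵥ ξ t)) =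
      -((1 / p.γ ^ 2) • ((p.sig (μ t))ᵀ *ᵥ ((P t - Q) *ᵥ ξ t))) := by
    rw [hw, Matrix.sub_mulVec, Matrix.mulVec_sub, smul_sub, neg_sub]
  have hcost := hsub t ht (ξ t)
  rw [quadForm_sub, quadForm_mul_mul ((hsymm t).sub hQ), quadForm_S] at hcost
  rw [hgain, neg_dotProduct, dotProduct_neg, neg_neg, smul_dotProduct, dotProduct_smul]
  convert hcost using 2
  simp only [smul_eq_mul]
  field_simp

/-! ### Consistency of the Euler scheme for the Riccati equation -/

/-- `g` bounds from above the payoff over `[0, T]` with terminal reward `f`, whatever the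
disturbance and the switching control with values in `U`. -/
def Dominates (p : SwitchingLQ n k M) (U : Set (Fin M)) (T : ℝ) (f g : (Fin n → ℝ) → ℝ) : Prop :=
  ∀ ⦃x w μ ξ⦄, p.IsAdmissible x T w μ ξ → (∀ t, μ t ∈ U) → p.running T w μ ξ + f (ξ T) ≤ g x

/-- From every initial state, the constant index `m` and some disturbance achieve at least `g` over
`[0, T]` with terminal reward `f`. -/
def Achieves (p : SwitchingLQ n k M) (m : Fin M) (T : ℝ) (f g : (Fin n → ℝ) → ℝ) : Prop :=
  ∀ x, ∃ w ξ, p.IsAdmissible x T w (fun _ => m) ξ ∧ g x ≤ p.running T w (fun _ => m) ξ + f (ξ T)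

/-- One step of the explicit Euler scheme for the Riccati equation of index `m`. -/
noncomputable def euler (p : SwitchingLQ n k M) (τ : ℝ) (R : Matrix (Fin n) (Fin n) ℝ)
    (m : Fin M) : Matrix (Fin n) (Fin n) ℝ :=
  R + τ • p.ric m R

/-- The time during which `μ` takes the value `m` in `[t, T]`. -/
noncomputable def occupation (T : ℝ) (μ : ℝ → Fin M) (m : Fin M) (t : ℝ) : ℝ :=
  ∫ s in t..T, if μ s = m then 1 else 0

theorem hasACDeriv_occupation {T : ℝ} {μ : ℝ → Fin M} (hμ : Measurable μ) (m : Fin M) :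
    HasACDeriv 0 T (occupation T μ m) (fun t => -if μ t = m then 1 else 0) := by
  have hint := intervalIntegrable_comp_index hμ fun j => if j = m then (1 : ℝ) else 0
  convert HasACDeriv.const_add_integral (occupation T μ m 0) (hint 0 T).neg using 1
  swap
  · rfl
  funext t
  rw [occupation, occupation, ← intervalIntegral.integral_add_adjacent_intervals (hint 0 t)
    (hint t T)]
  simp only [Pi.neg_apply, intervalIntegral.integral_neg]
  ring

theorem occupation_nonneg {T : ℝ} {μ : ℝ → Fin M} {t : ℝ} (ht : t ≤ T) (m : Fin M) :
    0 ≤ occupation T μ m t :=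
  intervalIntegral.integral_nonneg ht fun s _ => by positivity

theorem occupation_eq_zero {T : ℝ} {μ : ℝ → Fin M} {m : Fin M} (hm : ∀ s, μ s ≠ m) (t : ℝ) :
    occupation T μ m t = 0 := by
  simp [occupation, hm]

theorem sum_occupation {T : ℝ} {μ : ℝ → Fin M} (hμ : Measurable μ) (t : ℝ) :
    ∑ m, occupation T μ m t = T - t := by
  simp only [occupation]
  rw [← intervalIntegral.integral_finsetSum fun m _ =>
    intervalIntegrable_comp_index hμ (fun j => if j = m then (1 : ℝ) else 0) t T]
  simp

theorem sum_occupation_mul_le {T : ℝ} (hT : 0 < T) {μ : ℝ → Fin M} (hμ : Measurable μ)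
    {q : Fin M → ℝ} {b : ℝ} (hq : ∀ t, T * q (μ t) ≤ b) :
    ∑ m, occupation T μ m 0 * q m ≤ b := by
  have hterm (m : Fin M) : occupation T μ m 0 * q m ≤ occupation T μ m 0 * (b / T) := by
    by_cases hm : ∃ t, μ t = m
    · obtain ⟨t, rfl⟩ := hm
      exact mul_le_mul_of_nonneg_left ((le_div_iff₀' hT).2 (hq t)) (occupation_nonneg hT.le _)
    · simp [occupation_eq_zero (not_exists.1 hm)]
  calc ∑ m, occupation T μ m 0 * q m ≤ ∑ m, occupation T μ m 0 * (b / T) :=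
        Finset.sum_le_sum fun m _ => hterm m
    _ = b := by rw [← Finset.sum_mul, sum_occupation hμ, sub_zero, mul_div_cancel₀ _ hT.ne']

/-- The first order approximation, backward from `P` at time `T`, of the solution of the Riccati
equations switched by `μ`, with a second order correction of size `c`. -/
noncomputable def eulerPath (p : SwitchingLQ n k M) (P : Matrix (Fin n) (Fin n) ℝ) (T c : ℝ)
    (μ : ℝ → Fin M) (t : ℝ) : Matrix (Fin n) (Fin n) ℝ :=
  P + (∑ m, occupation T μ m t • p.ric m P + (c * (T - t) ^ 2) • 1)

theorem eulerPath_right (P : Matrix (Fin n) (Fin n) ℝ) (T c : ℝ) (μ : ℝ → Fin M) :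
    p.eulerPath P T c μ T = P := by
  simp [eulerPath, occupation]

theorem quadForm_eulerPath_zero (P : Matrix (Fin n) (Fin n) ℝ) (T c : ℝ) (μ : ℝ → Fin M)
    (x : Fin n → ℝ) : quadForm (p.eulerPath P T c μ 0) x = quadForm P x +
      (∑ m, occupation T μ m 0 * quadForm (p.ric m P) x + c * T ^ 2 * quadForm 1 x) := by
  simp only [eulerPath, quadForm_add, quadForm_sum, quadForm_smul, sub_zero]

theorem eulerPath_zero_const (P : Matrix (Fin n) (Fin n) ℝ) (T c : ℝ) (m : Fin M) :
    p.eulerPath P T c (fun _ => m) 0 = p.euler T P m + (c * T ^ 2) • 1 := by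
  simp [eulerPath, euler, occupation, apply_ite, ite_smul, add_assoc]

theorem isSymm_eulerPath (hD : ∀ m, (p.D m).IsSymm) {P : Matrix (Fin n) (Fin n) ℝ}
    (hP : P.IsSymm) (T c : ℝ) (μ : ℝ → Fin M) (t : ℝ) : (p.eulerPath P T c μ t).IsSymm := by
  have hsum : (∑ m, occupation T μ m t • p.ric m P).IsSymm := by
    simp only [Matrix.IsSymm, Matrix.transpose_sum, Matrix.transpose_smul,
      (isSymm_ric (hD _) hP).eq]
  exact hP.add (hsum.add (Matrix.isSymm_one.smul _))

theorem hasACDeriv_eulerPath (P : Matrix (Fin n) (Fin n) ℝ) (T c : ℝ) {μ : ℝ → Fin M}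
    (hμ : Measurable μ) (i j : Fin n) :
    HasACDeriv 0 T (fun t => p.eulerPath P T c μ t i j)
      (fun t => (-p.ric (μ t) P - (2 * c * (T - t)) • 1 : Matrix (Fin n) (Fin n) ℝ) i j) := by
  have hsq (t : ℝ) : HasDerivAt (fun s => c * (T - s) ^ 2) (-(2 * c * (T - t))) t := by
    refine ((((hasDerivAt_id t).const_sub T).fun_pow 2).const_mul c).congr_deriv ?_
    simp only [id_eq]
    ring
  have hpath := (HasACDeriv.const (a := 0) (b := T) (P i j)).add
    ((HasACDeriv.sum Finset.univ fun m _ =>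
      (hasACDeriv_occupation hμ m).mul_const (p.ric m P i j)).add
      ((HasACDeriv.of_hasDerivAt hsq (by fun_prop)).mul_const
        ((1 : Matrix (Fin n) (Fin n) ℝ) i j)))
  convert hpath using 2 <;>
  simp [eulerPath, Matrix.sum_apply, sub_eq_add_neg]

section OperatorNorm

open scoped Matrix.Norms.L2Operator

theorem norm_eulerPath_sub_le {P : Matrix (Fin n) (Fin n) ℝ} {F : ℝ}
    (hF : ∀ m, ‖p.ric m P‖ ≤ F) {T c t : ℝ} (ht : t ≤ T) (hc : |c| * (T - t) ≤ 1)
    {μ : ℝ → Fin M} (hμ : Measurable μ) : ‖p.eulerPath P T c μ t - P‖ ≤ (T - t) * (F + 1) := by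
  have hsum : ‖∑ m, occupation T μ m t • p.ric m P‖ ≤ (T - t) * F := by
    rw [← sum_occupation hμ t, Finset.sum_mul]
    refine norm_sum_le_of_le _ fun m _ => ?_
    rw [norm_smul, Real.norm_of_nonneg (occupation_nonneg ht m)]
    exact mul_le_mul_of_nonneg_left (hF m) (occupation_nonneg ht m)
  have hone : ‖(c * (T - t) ^ 2) • (1 : Matrix (Fin n) (Fin n) ℝ)‖ ≤ T - t :=
    calc _ = |c| * (T - t) * (T - t) * ‖(1 : Matrix (Fin n) (Fin n) ℝ)‖ := by
          rw [norm_smul, Real.norm_eq_abs, abs_mul, abs_sq]; ring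
      _ ≤ 1 * (T - t) * 1 := by
          have := sub_nonneg.2 ht
          gcongr
          exact l2_opNorm_one_le
      _ = T - t := by ring
  rw [eulerPath, add_sub_cancel_left]
  exact (norm_add_le_of_le hsum hone).trans_eq (by ring)

theorem exists_l2_opNorm_le {ι : Type*} [Finite ι] (B : ι → Matrix (Fin n) (Fin k) ℝ) :
    ∃ b, 0 ≤ b ∧ ∀ i, ‖B i‖ ≤ b := by
  have := Fintype.ofFinite ι
  exact ⟨∑ i, ‖B i‖, Finset.sum_nonneg fun i _ => norm_nonneg _, fun i =>
    Finset.single_le_sum (f := fun i => ‖B i‖) (fun i _ => norm_nonneg _) (Finset.mem_univ i)⟩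

/-- The defect of the path `eulerPath` as a solution of the Riccati equation is of first order
in time, so that the correction `K (T - t)²` outweighs it. -/
theorem exists_eulerPath_defect_le (p : SwitchingLQ n k M) {ρ : ℝ} (hρ : 0 < ρ) :
    ∃ K : ℝ, 0 < K ∧ ∀ P ∈ loewnerInterval n 0 ρ, ∀ T c : ℝ, K * T ≤ 1 → |c| ≤ K →
      ∀ μ : ℝ → Fin M, Measurable μ → ∀ t ∈ Set.Icc 0 T, ∀ m y,
        quadForm (p.ric m (p.eulerPath P T c μ t)) y - quadForm (p.ric m P) y ≤
          2 * K * (T - t) * quadForm 1 y ∧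
        quadForm (p.ric m P) y - quadForm (p.ric m (p.eulerPath P T c μ t) -
            (p.eulerPath P T c μ t - P) * p.S m * (p.eulerPath P T c μ t - P)) y ≤
          2 * K * (T - t) * quadForm 1 y := by
  obtain ⟨a, ha, hA⟩ := exists_l2_opNorm_le p.A
  obtain ⟨s, hs, hS⟩ := exists_l2_opNorm_le p.S
  obtain ⟨d, hd, hD⟩ := exists_l2_opNorm_le p.D
  obtain ⟨F, hFdef⟩ : ∃ F, F = 2 * a * ρ + ρ * s * ρ + d := ⟨_, rfl⟩
  have hF : 0 ≤ F := hFdef ▸ by positivity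
  obtain ⟨K, hKdef⟩ : ∃ K, K = (a + ρ * s) * (F + 1) + s * (F + 1) ^ 2 + 1 := ⟨_, rfl⟩
  have hK : 1 ≤ K := hKdef ▸ le_add_of_nonneg_left (by positivity)
  refine ⟨K, by positivity, fun P hP T c hKT hc μ hμ t ht m y => ?_⟩
  have hPρ := l2_opNorm_le_of_mem_loewnerInterval hP hρ
  have hu : 0 ≤ T - t := sub_nonneg.2 ht.2
  have hKu : K * (T - t) ≤ 1 :=
    (mul_le_mul_of_nonneg_left (sub_le_self T ht.1) (by positivity)).trans hKT
  have hu1 : T - t ≤ 1 := (le_mul_of_one_le_left hu hK).trans hKu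
  have hE := norm_eulerPath_sub_le (p := p)
    (fun m => (norm_riccati_le (hA m) (hD m) (hS m) hPρ).trans_eq hFdef.symm) ht.2
    ((mul_le_mul_of_nonneg_right hc hu).trans hKu) hμ
  have hbounds := quadForm_riccati_sub_le (D := p.D m) (hA m) (hS m) hPρ hE y
  have hone := quadForm_one_nonneg y
  have hquad : (T - t) * (F + 1) * s * ((T - t) * (F + 1)) ≤ s * (F + 1) ^ 2 * (T - t) := by
    have := mul_le_mul_of_nonneg_left hu1 (show 0 ≤ s * (F + 1) ^ 2 * (T - t) by positivity)
    linarith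
  have hsq : 0 ≤ s * (F + 1) ^ 2 * (T - t) := by positivity
  constructor
  · refine hbounds.1.trans (mul_le_mul_of_nonneg_right ?_ hone)
    rw [hKdef]
    linarith
  · refine hbounds.2.trans (mul_le_mul_of_nonneg_right ?_ hone)
    rw [hKdef]
    linarith

end OperatorNorm

/-- Up to an error `K τ²`, the Euler step with matrix `P` is the semigroup of the control problem
applied to the quadratic form of `P`, for `0 ≤ P ≤ ρ I`: from above for all switching controls,
from below for every constant one. -/
structure EulerConsistent (p : SwitchingLQ n k M) (ρ K τ : ℝ) : Prop where
  dominates : ∀ {P : Matrix (Fin n) (Fin n) ℝ}, P ∈ loewnerInterval n 0 ρ →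
    ∀ {U : Set (Fin M)} {g : (Fin n → ℝ) → ℝ},
    (∀ m ∈ U, ∀ x, quadForm (p.euler τ P m) x + K * τ ^ 2 * quadForm 1 x ≤ g x) →
    p.Dominates U τ (quadForm P) g
  achieves : ∀ {P : Matrix (Fin n) (Fin n) ℝ}, P ∈ loewnerInterval n 0 ρ → ∀ m : Fin M,
    p.Achieves m τ (quadForm P) (fun x => quadForm (p.euler τ P m) x - K * τ ^ 2 * quadForm 1 x)

theorem exists_eulerConsistent (hγ : p.γ ≠ 0) (hD : ∀ m, (p.D m).IsSymm) {ρ : ℝ} (hρ : 0 < ρ) :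
    ∃ K : ℝ, 0 < K ∧ ∀ τ : ℝ, 0 < τ → K * τ ≤ 1 → p.EulerConsistent ρ K τ := by
  obtain ⟨K, hK, hdefect⟩ := p.exists_eulerPath_defect_le hρ
  refine ⟨K, hK, fun τ hτ hKτ => ⟨?_, ?_⟩⟩
  · intro P hP U g hg x w μ ξ h hU
    have hpay := h.running_add_quadForm_le hγ hτ.le
      (isSymm_eulerPath hD (mem_loewnerInterval_iff.1 hP).1 τ K μ)
      (hasACDeriv_eulerPath P τ K h.measurable) fun t ht => by
        have := (hdefect P hP τ K hKτ (abs_of_pos hK).le μ h.measurable t ht (μ t) (ξ t)).1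
        simp only [quadForm_add, quadForm_sub, quadForm_neg, quadForm_smul]
        linarith
    rw [eulerPath_right, quadForm_eulerPath_zero] at hpay
    have havg := sum_occupation_mul_le hτ h.measurable (q := fun m => quadForm (p.ric m P) x)
      (b := g x - quadForm P x - K * τ ^ 2 * quadForm 1 x) fun t => by
        have := hg (μ t) (hU t) x
        rw [euler, quadForm_add, quadForm_smul] at this
        linarith
    linarith
  · intro P hP m x
    have hsymm := (mem_loewnerInterval_iff.1 hP).1
    obtain ⟨ξ, hw, hξ⟩ :=
      p.exists_isTrajectory_feedback m ((1 / p.γ ^ 2) • ((p.sig m)ᵀ * P)) x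
    have h : p.IsAdmissible x τ _ (fun _ => m) ξ := ⟨hw, measurable_const, hξ τ⟩
    refine ⟨_, ξ, h, ?_⟩
    have hpay := h.le_running_add_quadForm (Q := P)
      (fun t => by rw [Matrix.smul_mulVec, Matrix.mulVec_mulVec]) hγ hτ.le hsymm
      (isSymm_eulerPath hD hsymm τ (-K) fun _ => m)
      (hasACDeriv_eulerPath P τ (-K) h.measurable) fun t ht y => by
        have := (hdefect P hP τ (-K) hKτ (by rw [abs_neg, abs_of_pos hK]) _ h.measurable t ht m
          y).2
        simp only [quadForm_add, quadForm_sub, quadForm_neg, quadForm_smul] at this ⊢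
        linarith
    rw [eulerPath_right, eulerPath_zero_const, quadForm_add, quadForm_smul] at hpay
    linarith

/-! ### One Euler step below a strict supersolution -/

/-- The matrix `lam I` is a strict supersolution of all the Riccati equations, and below it the
quadratic part of the Riccati operator is strictly dominated by its constant part. -/
structure StrictBound (p : SwitchingLQ n k M) (lam δ : ℝ) : Prop where
  γ_ne_zero : p.γ ≠ 0
  lam_pos : 0 < lam
  δ_pos : 0 < δ
  isSymm_D : ∀ m, (p.D m).IsSymm
  ric_le : ∀ m x, quadForm (p.ric m (lam • 1)) x ≤ -δ * quadForm 1 x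
  gap : ∀ R ∈ loewnerInterval n 0 lam, ∀ m x,
    (1 + δ) * quadForm (R * p.S m * R) x + δ * quadForm 1 x ≤ quadForm (p.D m) x

/-- What one Euler step with time step `τ` retains of the semigroup on `[0, lam I]`: the constant
supersolution `lam I` contracts by a factor `1 - θ`, and the step itself is exact up to a factor
`1 ± a`. -/
structure StepBounds (p : SwitchingLQ n k M) (lam τ a θ : ℝ) : Prop where
  τ_pos : 0 < τ
  a_nonneg : 0 ≤ a
  θ_pos : 0 < θ
  θ_le_one : θ ≤ 1
  decay : p.Dominates Set.univ τ (quadForm (lam • 1)) (fun x => (1 - θ) * quadForm (lam • 1) x)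
  euler_mem : ∀ R ∈ loewnerInterval n 0 lam, ∀ m, p.euler τ R m ∈ loewnerInterval n 0 lam
  dominates : ∀ R ∈ loewnerInterval n 0 lam, ∀ {U : Set (Fin M)} {g : (Fin n → ℝ) → ℝ},
    (∀ m ∈ U, ∀ x, (1 + a) * quadForm (p.euler τ R m) x ≤ g x) →
    p.Dominates U τ (fun x => (1 + a) * quadForm R x) g
  achieves : ∀ R ∈ loewnerInterval n 0 lam, ∀ m, p.Achieves m τ (fun x => (1 - a) * quadForm R x)
    (fun x => (1 - a) * quadForm (p.euler τ R m) x)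

theorem isSymm_euler (hD : ∀ m, (p.D m).IsSymm) {R : Matrix (Fin n) (Fin n) ℝ} (hR : R.IsSymm)
    (τ : ℝ) (m : Fin M) : (p.euler τ R m).IsSymm :=
  hR.add ((isSymm_ric (hD m) hR).smul τ)

theorem quadForm_euler (R : Matrix (Fin n) (Fin n) ℝ) (τ : ℝ) (m : Fin M) (x : Fin n → ℝ) :
    quadForm (p.euler τ R m) x = quadForm R x + τ * quadForm (p.ric m R) x := by
  rw [euler, quadForm_add, quadForm_smul]

theorem quadForm_euler_smul (r : ℝ) (R : Matrix (Fin n) (Fin n) ℝ) (τ : ℝ) (m : Fin M)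
    (x : Fin n → ℝ) : quadForm (p.euler τ (r • R) m) x = r * quadForm (p.euler τ R m) x +
      τ * ((1 - r) * (quadForm (p.D m) x - r * quadForm (R * p.S m * R) x)) := by
  rw [quadForm_euler, quadForm_euler, quadForm_smul, ric, quadForm_riccati_smul, ← ric]
  ring

theorem smul_mem_loewnerInterval {R : Matrix (Fin n) (Fin n) ℝ} {b r c : ℝ}
    (hR : R ∈ loewnerInterval n 0 b) (hr : 0 ≤ r) (hc : r * b ≤ c) :
    r • R ∈ loewnerInterval n 0 c := by
  obtain ⟨hsymm, hbounds⟩ := mem_loewnerInterval_iff.1 hR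
  refine mem_loewnerInterval_iff.2 ⟨hsymm.smul r, fun x => ?_⟩
  obtain ⟨hlow, hup⟩ := hbounds x
  have hone := quadForm_one_nonneg x
  rw [quadForm_smul]
  constructor <;> nlinarith

theorem quadForm_mul_S_mul_nonneg {R : Matrix (Fin n) (Fin n) ℝ} (hR : R.IsSymm) (m : Fin M)
    (x : Fin n → ℝ) : 0 ≤ quadForm (R * p.S m * R) x := by
  rw [quadForm_mul_mul hR]
  exact p.quadForm_S_nonneg m _

theorem quadForm_nonneg_of_mem {R : Matrix (Fin n) (Fin n) ℝ} {b : ℝ}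
    (hR : R ∈ loewnerInterval n 0 b) (x : Fin n → ℝ) : 0 ≤ quadForm R x := by
  simpa using ((mem_loewnerInterval_iff.1 hR).2 x).1

theorem quadForm_le_of_mem {R : Matrix (Fin n) (Fin n) ℝ} {b : ℝ}
    (hR : R ∈ loewnerInterval n 0 b) (x : Fin n → ℝ) : quadForm R x ≤ b * quadForm 1 x :=
  ((mem_loewnerInterval_iff.1 hR).2 x).2

theorem smul_one_mem_loewnerInterval {r b : ℝ} (hr : 0 ≤ r) (hb : r ≤ b) :
    r • (1 : Matrix (Fin n) (Fin n) ℝ) ∈ loewnerInterval n 0 b :=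
  smul_mem_loewnerInterval (b := 1) (mem_loewnerInterval_iff.2 ⟨Matrix.isSymm_one, fun x =>
    ⟨by simpa using quadForm_one_nonneg x, by simp⟩⟩) hr (by simpa using hb)

/-- The semigroup is order preserving, hence so is the Euler step up to its consistency error. -/
theorem EulerConsistent.quadForm_euler_le {ρ K τ : ℝ} (h : p.EulerConsistent ρ K τ)
    {P Q : Matrix (Fin n) (Fin n) ℝ} (hP : P ∈ loewnerInterval n 0 ρ)
    (hQ : Q ∈ loewnerInterval n 0 ρ) (hPQ : ∀ x, quadForm P x ≤ quadForm Q x) (m : Fin M)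
    (x : Fin n → ℝ) : quadForm (p.euler τ P m) x ≤
      quadForm (p.euler τ Q m) x + 2 * (K * τ ^ 2 * quadForm 1 x) := by
  obtain ⟨w, ξ, hadm, hlow⟩ := h.achieves hP m x
  have hup := h.dominates (U := {m}) hQ (fun j hj y => by rw [Set.mem_singleton_iff.1 hj])
    hadm fun _ => rfl
  linarith [hPQ (ξ τ)]

namespace StrictBound

variable {lam δ : ℝ}

theorem decay (h : p.StrictBound lam δ) {ρ K τ : ℝ} (hcons : p.EulerConsistent ρ K τ)
    (hlam : lam ≤ ρ) (hτ : 0 ≤ τ) (hKτ : 2 * (K * τ) ≤ δ) :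
    p.Dominates Set.univ τ (quadForm (lam • 1))
      (fun x => (1 - δ / (2 * lam) * τ) * quadForm (lam • 1) x) := by
  have hlam_pos := h.lam_pos
  refine hcons.dominates (smul_one_mem_loewnerInterval h.lam_pos.le hlam) fun m _ x => ?_
  have hone := quadForm_one_nonneg x
  have hric := mul_le_mul_of_nonneg_left (h.ric_le m x) hτ
  have herr := mul_le_mul_of_nonneg_right hKτ (mul_nonneg hτ hone)
  rw [quadForm_euler]
  simp only [quadForm_smul] at hric ⊢
  field_simp
  linarith

theorem euler_mem (h : p.StrictBound lam δ) {ρ K τ : ℝ} (hcons : p.EulerConsistent ρ K τ)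
    (hlam : lam ≤ ρ) (hτ : 0 ≤ τ) (hKτ : 2 * (K * τ) ≤ δ) {R : Matrix (Fin n) (Fin n) ℝ}
    (hR : R ∈ loewnerInterval n 0 lam) (m : Fin M) :
    p.euler τ R m ∈ loewnerInterval n 0 lam := by
  have hRρ := loewnerInterval_subset le_rfl hlam hR
  refine mem_loewnerInterval_iff.2
    ⟨isSymm_euler h.isSymm_D (mem_loewnerInterval_iff.1 hR).1 τ m, fun x => ?_⟩
  have hone := mul_nonneg hτ (quadForm_one_nonneg x)
  have herr := mul_le_mul_of_nonneg_right hKτ hone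
  constructor
  · have hzero := smul_mem_loewnerInterval hRρ le_rfl (by simpa using h.lam_pos.le.trans hlam)
    have hcomp := hcons.quadForm_euler_le hzero hRρ
      (fun y => by simpa only [quadForm_smul, zero_mul] using quadForm_nonneg_of_mem hR y) m x
    have hgap := mul_le_mul_of_nonneg_left (h.gap _ hR m x) hτ
    have hS := mul_nonneg hτ
      (quadForm_mul_S_mul_nonneg (p := p) (mem_loewnerInterval_iff.1 hR).1 m x)
    rw [quadForm_euler_smul] at hcomp
    linarith [mul_nonneg h.δ_pos.le hS]
  · have hcomp := hcons.quadForm_euler_le hRρ (smul_one_mem_loewnerInterval h.lam_pos.le hlam)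
      (fun y => by simpa [quadForm_smul] using quadForm_le_of_mem hR y) m x
    have hric := mul_le_mul_of_nonneg_left (h.ric_le m x) hτ
    rw [quadForm_euler (lam • 1), quadForm_smul] at hcomp
    linarith

theorem dominates_smul (h : p.StrictBound lam δ) {ρ K τ a : ℝ} (hcons : p.EulerConsistent ρ K τ)
    (ha : δ * a = K * τ) (ha₀ : 0 ≤ a) (haδ : a ≤ δ) (hρ : (1 + a) * lam ≤ ρ) (hτ : 0 ≤ τ)
    {R : Matrix (Fin n) (Fin n) ℝ} (hR : R ∈ loewnerInterval n 0 lam) {U : Set (Fin M)}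
    {g : (Fin n → ℝ) → ℝ} (hg : ∀ m ∈ U, ∀ x, (1 + a) * quadForm (p.euler τ R m) x ≤ g x) :
    p.Dominates U τ (fun x => (1 + a) * quadForm R x) g := by
  simp only [← quadForm_smul (1 + a) R]
  refine hcons.dominates (smul_mem_loewnerInterval hR (by positivity) hρ) fun m hm x => ?_
  have hS := quadForm_mul_S_mul_nonneg (p := p) (mem_loewnerInterval_iff.1 hR).1 m x
  have hgap : δ * quadForm 1 x ≤ quadForm (p.D m) x - (1 + a) * quadForm (R * p.S m * R) x := by
    linarith [h.gap R hR m x, mul_le_mul_of_nonneg_right haδ hS]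
  have hgain := mul_le_mul_of_nonneg_left hgap (mul_nonneg hτ ha₀)
  have herr : K * τ ^ 2 * quadForm 1 x = τ * a * (δ * quadForm 1 x) := by
    linear_combination -τ * quadForm 1 x * ha
  rw [quadForm_euler_smul]
  linarith [hg m hm x]

theorem achieves_smul (h : p.StrictBound lam δ) {ρ K τ a : ℝ} (hcons : p.EulerConsistent ρ K τ)
    (ha : δ * a = K * τ) (ha₀ : 0 ≤ a) (ha₁ : a ≤ 1) (hρ : lam ≤ ρ) (hτ : 0 ≤ τ)
    {R : Matrix (Fin n) (Fin n) ℝ} (hR : R ∈ loewnerInterval n 0 lam) (m : Fin M) :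
    p.Achieves m τ (fun x => (1 - a) * quadForm R x)
      (fun x => (1 - a) * quadForm (p.euler τ R m) x) := by
  simp only [← quadForm_smul (1 - a) R]
  have hmem : (1 - a) • R ∈ loewnerInterval n 0 ρ :=
    smul_mem_loewnerInterval hR (sub_nonneg.2 ha₁) (by nlinarith [h.lam_pos])
  intro x
  obtain ⟨w, ξ, hadm, hle⟩ := hcons.achieves hmem m x
  refine ⟨w, ξ, hadm, le_trans ?_ hle⟩
  have hS := quadForm_mul_S_mul_nonneg (p := p) (mem_loewnerInterval_iff.1 hR).1 m x
  have hgap : δ * quadForm 1 x ≤ quadForm (p.D m) x - (1 - a) * quadForm (R * p.S m * R) x := by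
    linarith [h.gap R hR m x, mul_nonneg h.δ_pos.le hS, mul_nonneg ha₀ hS]
  have hgain := mul_le_mul_of_nonneg_left hgap (mul_nonneg hτ ha₀)
  have herr : K * τ ^ 2 * quadForm 1 x = τ * a * (δ * quadForm 1 x) := by
    linear_combination -τ * quadForm 1 x * ha
  simp only [quadForm_euler_smul]
  linarith

theorem exists_stepBounds (h : p.StrictBound lam δ) : ∃ κ c : ℝ, 0 < κ ∧ 0 < c ∧
    ∀ᶠ τ in 𝓝[>] (0 : ℝ), p.StepBounds lam τ (c * τ) (κ * τ) := by
  have hlam := h.lam_pos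
  have hδ := h.δ_pos
  obtain ⟨K, hK, hcons⟩ := exists_eulerConsistent h.γ_ne_zero h.isSymm_D (mul_pos two_pos hlam)
  have hsmall {b r : ℝ} (hr : 0 < r) : ∀ᶠ τ in 𝓝[>] (0 : ℝ), b * τ ≤ r :=
    (((continuous_const_mul b).tendsto' 0 0 (mul_zero b)).eventually_le_const hr).filter_mono
      nhdsWithin_le_nhds
  refine ⟨δ / (2 * lam), K / δ, by positivity, by positivity, ?_⟩
  filter_upwards [self_mem_nhdsWithin, hsmall one_pos (b := K), hsmall (half_pos hδ) (b := K),
    hsmall (lt_min one_pos hδ) (b := K / δ), hsmall one_pos (b := δ / (2 * lam))]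
    with τ hτ hK1 hKδ hc hκ
  have hcons := hcons τ hτ hK1
  have hτ₀ : 0 < τ := hτ
  have ha : δ * (K / δ * τ) = K * τ := by field_simp
  have ha₀ : 0 ≤ K / δ * τ := by positivity
  obtain ⟨ha₁, haδ⟩ := le_min_iff.1 hc
  exact ⟨hτ₀, ha₀, by positivity, hκ,
    h.decay hcons (by linarith) hτ₀.le (by linarith),
    fun R hR m => h.euler_mem hcons (by linarith) hτ₀.le (by linarith) hR m,
    fun R hR _ _ hg => h.dominates_smul hcons ha ha₀ haδ (by nlinarith) hτ₀.le hR hg,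
    fun R hR m => h.achieves_smul hcons ha ha₀ ha₁ (by linarith) hτ₀.le hR m⟩

end StrictBound

/-! ### Splitting and concatenation of trajectories -/

/-- `w` is measurable and square integrable on `(a, b]`. -/
def IsSquareIntegrableOn (w : ℝ → Fin k → ℝ) (a b : ℝ) : Prop :=
  AEStronglyMeasurable w (volume.restrict (Set.Ioc a b)) ∧
    IntegrableOn (fun t => w t ⬝ᵥ w t) (Set.Ioc a b)

theorem isDisturbance_iff {w : ℝ → Fin k → ℝ} :
    IsDisturbance w ↔ ∀ T, IsSquareIntegrableOn w 0 T := by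
  simp only [IsDisturbance, IsSquareIntegrableOn, IntegrableOn, restrict_Ioc_eq_restrict_Icc]

namespace IsSquareIntegrableOn

variable {w w' : ℝ → Fin k → ℝ} {a b c : ℝ}

theorem mono (h : IsSquareIntegrableOn w a b) {a' b' : ℝ} (ha : a ≤ a') (hb : b' ≤ b) :
    IsSquareIntegrableOn w a' b' :=
  ⟨h.1.mono_measure (Measure.restrict_mono (Set.Ioc_subset_Ioc ha hb) le_rfl),
    h.2.mono_set (Set.Ioc_subset_Ioc ha hb)⟩

theorem congr (h : IsSquareIntegrableOn w a b) (hw : ∀ t ∈ Set.Ioc a b, w t = w' t) :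
    IsSquareIntegrableOn w' a b :=
  ⟨h.1.congr ((ae_restrict_iff' measurableSet_Ioc).2 (.of_forall hw)),
    h.2.congr_fun (fun t ht => by simp only [hw t ht]) measurableSet_Ioc⟩

theorem union (h : IsSquareIntegrableOn w a b) (h' : IsSquareIntegrableOn w b c) (hab : a ≤ b)
    (hbc : b ≤ c) : IsSquareIntegrableOn w a c := by
  rw [IsSquareIntegrableOn, ← Set.Ioc_union_Ioc_eq_Ioc hab hbc]
  exact ⟨aestronglyMeasurable_union_iff.2 ⟨h.1, h'.1⟩, h.2.union h'.2⟩

theorem comp_add_right (h : IsSquareIntegrableOn w (a + c) (b + c)) :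
    IsSquareIntegrableOn (fun t => w (t + c)) a b := by
  have hp := (measurePreserving_add_right volume c).restrict_preimage
    (measurableSet_Ioc (a := a + c) (b := b + c))
  simp only [Set.preimage_add_const_Ioc, add_sub_cancel_right] at hp
  exact ⟨h.1.comp_measurePreserving hp, (hp.integrable_comp h.2.aestronglyMeasurable).2 h.2⟩

end IsSquareIntegrableOn

theorem IsDisturbance.comp_add_right {w : ℝ → Fin k → ℝ} (hw : IsDisturbance w) {T : ℝ}
    (hT : 0 ≤ T) : IsDisturbance fun t => w (t + T) := by
  rw [isDisturbance_iff] at hw ⊢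
  exact fun T' => ((hw (T' + T)).mono (by simpa using hT) le_rfl).comp_add_right

/-- `f` up to time `T` and `g`, started at time `T`, afterwards. -/
noncomputable def concatAt {α : Type*} (T : ℝ) (f g : ℝ → α) (t : ℝ) : α :=
  if t ≤ T then f t else g (t - T)

theorem concatAt_of_le {α : Type*} {T : ℝ} {f g : ℝ → α} {t : ℝ} (ht : t ≤ T) :
    concatAt T f g t = f t := if_pos ht

theorem concatAt_of_lt {α : Type*} {T : ℝ} {f g : ℝ → α} {t : ℝ} (ht : T < t) :
    concatAt T f g t = g (t - T) := if_neg ht.not_ge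

theorem concatAt_add_right {α : Type*} {T : ℝ} {f g : ℝ → α} {t : ℝ} (ht : 0 < t) :
    concatAt T f g (t + T) = g t := by
  rw [concatAt_of_lt (lt_add_of_pos_left T ht), add_sub_cancel_right]

theorem IsDisturbance.concatAt {w w' : ℝ → Fin k → ℝ} (hw : IsDisturbance w)
    (hw' : IsDisturbance w') {T : ℝ} (hT : 0 ≤ T) : IsDisturbance (concatAt T w w') := by
  rw [isDisturbance_iff] at hw hw' ⊢
  intro T'
  rcases le_total T' T with h | h
  · exact (hw T').congr fun t ht => (concatAt_of_le (ht.2.trans h)).symm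
  · refine ((hw T).congr fun t ht => (concatAt_of_le ht.2).symm).union ?_ hT h
    have hshift : IsSquareIntegrableOn (fun t => w' (t + -T)) T T' :=
      ((hw' (T' + -T)).mono (by simp) le_rfl).comp_add_right
    exact hshift.congr fun t ht => (concatAt_of_lt ht.1).symm

theorem measurable_concatAt {μ μ' : ℝ → Fin M} (hμ : Measurable μ) (hμ' : Measurable μ') (T : ℝ) :
    Measurable (concatAt T μ μ') :=
  Measurable.ite measurableSet_Iic hμ (hμ'.comp (measurable_id.sub_const T))

section Congr

variable {x : Fin n → ℝ} {T : ℝ} {w w' : ℝ → Fin k → ℝ} {μ μ' : ℝ → Fin M}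
  {ξ ξ' : ℝ → Fin n → ℝ}

theorem running_congr (p : SwitchingLQ n k M) (hT : 0 ≤ T) (hw : ∀ t ∈ Set.Ioc 0 T, w t = w' t)
    (hμ : ∀ t ∈ Set.Ioc 0 T, μ t = μ' t) (hξ : ∀ t ∈ Set.Ioc 0 T, ξ t = ξ' t) :
    p.running T w μ ξ = p.running T w' μ' ξ' :=
  intervalIntegral.integral_congr_ae (.of_forall fun t ht => by
    rw [Set.uIoc_of_le hT] at ht
    rw [hw t ht, hμ t ht, hξ t ht])

theorem IsTrajectory.congr (h : p.IsTrajectory x T w μ ξ) (hw : ∀ t ∈ Set.Ioc 0 T, w t = w' t)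
    (hμ : ∀ t ∈ Set.Ioc 0 T, μ t = μ' t) (hξ : ∀ t ∈ Set.Icc 0 T, ξ t = ξ' t) :
    p.IsTrajectory x T w' μ' ξ' := by
  refine ⟨h.1.congr fun t ht => (hξ t ht).symm, fun t ht => ?_⟩
  rw [← hξ t ht, h.2 t ht, intervalIntegral.integral_congr_ae (.of_forall fun s hs => ?_)]
  rw [Set.uIoc_of_le ht.1] at hs
  have hsT := Set.Ioc_subset_Ioc_right ht.2 hs
  rw [hw s hsT, hμ s hsT, hξ s (Set.Ioc_subset_Icc_self hsT)]

end Congr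

theorem continuousOn_Icc_add_iff {E : Type*} [TopologicalSpace E] {f : ℝ → E} {S T : ℝ}
    (hS : 0 ≤ S) (hT : 0 ≤ T) : ContinuousOn f (Set.Icc 0 (S + T)) ↔
      ContinuousOn f (Set.Icc 0 S) ∧ ContinuousOn (fun t => f (t + S)) (Set.Icc 0 T) := by
  have hshift : ContinuousOn (fun t => f (t + S)) (Set.Icc 0 T) ↔
      ContinuousOn f (Set.Icc S (S + T)) := by
    have himage : Set.Icc S (S + T) = Homeomorph.addRight S '' Set.Icc 0 T := by
      simp [add_comm]
    rw [himage, (Homeomorph.addRight S).isOpenEmbedding.continuousOn_image_iff]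
    rfl
  rw [hshift, ← Set.Icc_union_Icc_eq_Icc hS (le_add_of_nonneg_right hT)]
  exact ⟨fun h => ⟨h.mono Set.subset_union_left, h.mono Set.subset_union_right⟩,
    fun h => h.1.union_of_isClosed h.2 isClosed_Icc isClosed_Icc⟩

theorem isTrajectory_add_iff {x : Fin n → ℝ} {S T : ℝ} (hS : 0 ≤ S) (hT : 0 ≤ T)
    {w : ℝ → Fin k → ℝ} (hw : IsDisturbance w) {μ : ℝ → Fin M} (hμ : Measurable μ)
    {ξ : ℝ → Fin n → ℝ} : p.IsTrajectory x (S + T) w μ ξ ↔ p.IsTrajectory x S w μ ξ ∧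
      p.IsTrajectory (ξ S) T (fun t => w (t + S)) (fun t => μ (t + S)) (fun t => ξ (t + S)) := by
  rw [IsTrajectory, IsTrajectory, IsTrajectory, and_and_and_comm,
    ← continuousOn_Icc_add_iff hS hT]
  refine and_congr_right fun hξ => ?_
  set v := fun s => p.A (μ s) *ᵥ ξ s + p.sig (μ s) *ᵥ w s
  have hint {a b : ℝ} (ha : a ∈ Set.Icc 0 (S + T)) (hb : b ∈ Set.Icc 0 (S + T)) :
      IntervalIntegrable v volume a b :=
    (p.intervalIntegrable_drift (add_nonneg hS hT) hw hμ hξ).mono_set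
      ((Set.uIcc_subset_Icc ha hb).trans_eq (Set.uIcc_of_le (add_nonneg hS hT)).symm)
  have hS_mem : S ∈ Set.Icc 0 (S + T) := ⟨hS, by linarith⟩
  have h0_mem : (0 : ℝ) ∈ Set.Icc 0 (S + T) := ⟨le_rfl, by linarith⟩
  have hshift {t : ℝ} (ht : t ∈ Set.Icc 0 T) :
      (∫ s in (0 : ℝ)..t, v (s + S)) = (∫ s in (0 : ℝ)..(t + S), v s) - ∫ s in (0 : ℝ)..S, v s := by
    rw [intervalIntegral.integral_comp_add_right, zero_add,
      intervalIntegral.integral_interval_sub_left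
        (hint h0_mem ⟨by linarith [ht.1], by linarith [ht.2]⟩) (hint h0_mem hS_mem)]
  constructor
  · intro h
    refine ⟨fun t ht => h t ⟨ht.1, by linarith [ht.2]⟩, fun t ht => ?_⟩
    rw [hshift ht, h S hS_mem, h (t + S) ⟨by linarith [ht.1], by linarith [ht.2]⟩]
    abel
  · rintro ⟨hleft, hright⟩ t ht
    rcases le_total t S with htS | hSt
    · exact hleft t ⟨ht.1, htS⟩
    · have htS : t - S ∈ Set.Icc 0 T := ⟨by linarith, by linarith [ht.2]⟩
      have := hright (t - S) htS
      rw [hshift htS, hleft S ⟨hS, le_rfl⟩, sub_add_cancel] at this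
      rw [this]
      abel

theorem running_add (p : SwitchingLQ n k M) {S T : ℝ} (hS : 0 ≤ S) (hT : 0 ≤ T)
    {w : ℝ → Fin k → ℝ} (hw : IsDisturbance w) {μ : ℝ → Fin M} (hμ : Measurable μ)
    {ξ : ℝ → Fin n → ℝ} (hξ : ContinuousOn ξ (Set.Icc 0 (S + T))) :
    p.running (S + T) w μ ξ = p.running S w μ ξ +
      p.running T (fun t => w (t + S)) (fun t => μ (t + S)) (fun t => ξ (t + S)) := by
  have hint := p.intervalIntegrable_payoff (add_nonneg hS hT) hw hμ hξ
  have hmem : S ∈ Set.uIcc 0 (S + T) := Set.uIcc_of_le (add_nonneg hS hT) ▸ ⟨hS, by linarith⟩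
  simp only [running]
  rw [intervalIntegral.integral_comp_add_right (fun t => (1 / 2) * (ξ t ⬝ᵥ (p.D (μ t) *ᵥ ξ t)) -
      p.γ ^ 2 / 2 * (w t ⬝ᵥ w t)), zero_add, add_comm T S,
    intervalIntegral.integral_add_adjacent_intervals
      (hint.mono_set (Set.uIcc_subset_uIcc Set.left_mem_uIcc hmem))
      (hint.mono_set (Set.uIcc_subset_uIcc hmem Set.right_mem_uIcc))]

theorem IsAdmissible.concat {x : Fin n → ℝ} {S T : ℝ} (hS : 0 ≤ S) (hT : 0 ≤ T)
    {w w' : ℝ → Fin k → ℝ} {μ μ' : ℝ → Fin M} {ξ ξ' : ℝ → Fin n → ℝ}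
    (h : p.IsAdmissible x S w μ ξ) (h' : p.IsAdmissible (ξ S) T w' μ' ξ') :
    p.IsAdmissible x (S + T) (concatAt S w w') (concatAt S μ μ') (concatAt S ξ ξ') ∧
    p.running (S + T) (concatAt S w w') (concatAt S μ μ') (concatAt S ξ ξ') =
      p.running S w μ ξ + p.running T w' μ' ξ' := by
  have hw := h.isDisturbance.concatAt h'.isDisturbance hS
  have hμ := measurable_concatAt h.measurable h'.measurable S
  have hleft {α : Type} (f g : ℝ → α) : ∀ t ∈ Set.Icc 0 S, f t = concatAt S f g t :=
    fun t ht => (concatAt_of_le ht.2).symm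
  have hright {α : Type} (f g : ℝ → α) : ∀ t ∈ Set.Ioc 0 T, g t = concatAt S f g (t + S) :=
    fun t ht => (concatAt_add_right ht.1).symm
  have hξright : ∀ t ∈ Set.Icc 0 T, ξ' t = concatAt S ξ ξ' (t + S) := fun t ht => by
    rcases ht.1.eq_or_lt with rfl | hlt
    · rw [zero_add, concatAt_of_le le_rfl, h'.isTrajectory.apply_zero hT]
    · exact hright ξ ξ' t ⟨hlt, ht.2⟩
  have htraj : p.IsTrajectory x (S + T) (concatAt S w w') (concatAt S μ μ') (concatAt S ξ ξ') := by
    refine (isTrajectory_add_iff hS hT hw hμ).2 ⟨?_, ?_⟩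
    · exact h.isTrajectory.congr (fun t ht => hleft w w' t (Set.Ioc_subset_Icc_self ht))
        (fun t ht => hleft μ μ' t (Set.Ioc_subset_Icc_self ht)) (hleft ξ ξ')
    · rw [concatAt_of_le le_rfl]
      exact h'.isTrajectory.congr (hright w w') (hright μ μ') hξright
  refine ⟨⟨hw, hμ, htraj⟩, ?_⟩
  rw [p.running_add hS hT hw hμ htraj.1]
  refine congr_arg₂ _ ?_ ?_
  · exact (p.running_congr hS (fun t ht => hleft w w' t (Set.Ioc_subset_Icc_self ht))
      (fun t ht => hleft μ μ' t (Set.Ioc_subset_Icc_self ht))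
      (fun t ht => hleft ξ ξ' t (Set.Ioc_subset_Icc_self ht))).symm
  · exact (p.running_congr hT (hright w w') (hright μ μ') (hright ξ ξ')).symm

theorem IsAdmissible.split {x : Fin n → ℝ} {S T : ℝ} (hS : 0 ≤ S) (hT : 0 ≤ T)
    {w : ℝ → Fin k → ℝ} {μ : ℝ → Fin M} {ξ : ℝ → Fin n → ℝ}
    (h : p.IsAdmissible x (S + T) w μ ξ) : p.IsAdmissible x S w μ ξ ∧
    p.IsAdmissible (ξ S) T (fun t => w (t + S)) (fun t => μ (t + S)) (fun t => ξ (t + S)) := by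
  obtain ⟨hleft, hright⟩ :=
    (isTrajectory_add_iff hS hT h.isDisturbance h.measurable).1 h.isTrajectory
  exact ⟨⟨h.isDisturbance, h.measurable, hleft⟩, h.isDisturbance.comp_add_right hS,
    h.measurable.comp (measurable_add_const S), hright⟩

/-! ### The value function -/

/-- The value function with real values; at states where `p.value` is infinite it is `0`. -/
noncomputable def realValue (p : SwitchingLQ n k M) (x : Fin n → ℝ) : ℝ :=
  (p.value x).toReal

theorem IsAdmissible.running_le_value {x : Fin n → ℝ} {T : ℝ} {w : ℝ → Fin k → ℝ}
    {μ : ℝ → Fin M} {ξ : ℝ → Fin n → ℝ} (h : p.IsAdmissible x T w μ ξ) (hT : 0 < T) :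
    (p.running T w μ ξ : EReal) ≤ p.value x :=
  le_iSup_of_le w <| le_iSup_of_le h.isDisturbance <| le_iSup_of_le μ <|
    le_iSup_of_le h.measurable <| le_iSup_of_le T <| le_iSup_of_le hT <| le_iSup_of_le ξ <|
    le_iSup_of_le h.isTrajectory le_rfl

theorem value_le {x : Fin n → ℝ} {b : EReal} (hb : ∀ ⦃T w μ ξ⦄, 0 < T →
    p.IsAdmissible x T w μ ξ → (p.running T w μ ξ : EReal) ≤ b) : p.value x ≤ b :=
  iSup_le fun _ => iSup_le fun hw => iSup_le fun _ => iSup_le fun hμ => iSup_le fun _ =>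
    iSup_le fun hT => iSup_le fun _ => iSup_le fun hξ => hb hT ⟨hw, hμ, hξ⟩

namespace StrictBound

variable {lam δ : ℝ}

theorem running_le (h : p.StrictBound lam δ) {x : Fin n → ℝ} {T : ℝ} (hT : 0 ≤ T)
    {w : ℝ → Fin k → ℝ} {μ : ℝ → Fin M} {ξ : ℝ → Fin n → ℝ} (hadm : p.IsAdmissible x T w μ ξ) :
    p.running T w μ ξ ≤ quadForm (lam • 1) x := by
  have henergy := hadm.running_add_quadForm_le h.γ_ne_zero hT (P := fun _ => lam • 1)
    (P' := fun _ => 0) (fun _ => Matrix.isSymm_one.smul lam) (fun i j => HasACDeriv.const _)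
    fun t _ => by
      rw [zero_add]
      exact (h.ric_le _ _).trans (mul_nonpos_of_nonpos_of_nonneg (neg_nonpos.2 h.δ_pos.le)
        (quadForm_one_nonneg _))
  exact (le_add_of_nonneg_right (quadForm_nonneg_of_mem
    (smul_one_mem_loewnerInterval h.lam_pos.le le_rfl) _)).trans henergy

theorem quadForm_D_nonneg (h : p.StrictBound lam δ) (m : Fin M) (x : Fin n → ℝ) :
    0 ≤ quadForm (p.D m) x := by
  have hmem := smul_one_mem_loewnerInterval (n := n) le_rfl h.lam_pos.le
  have hS := quadForm_mul_S_mul_nonneg (p := p) (mem_loewnerInterval_iff.1 hmem).1 m x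
  linarith [h.gap _ hmem m x, mul_nonneg h.δ_pos.le (quadForm_one_nonneg x),
    mul_nonneg h.δ_pos.le hS]

theorem exists_running_nonneg (h : p.StrictBound lam δ) (m : Fin M) {T : ℝ} (hT : 0 ≤ T)
    (x : Fin n → ℝ) : ∃ w ξ, p.IsAdmissible x T w (fun _ => m) ξ ∧
      0 ≤ p.running T w (fun _ => m) ξ := by
  obtain ⟨ξ, hw, hξ⟩ := p.exists_isTrajectory_feedback m 0 x
  refine ⟨_, ξ, ⟨hw, measurable_const, hξ T⟩,
    intervalIntegral.integral_nonneg hT fun t _ => ?_⟩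
  simpa [quadForm] using h.quadForm_D_nonneg m (ξ t)

theorem value_le_quadForm (h : p.StrictBound lam δ) (x : Fin n → ℝ) :
    p.value x ≤ (quadForm (lam • 1) x : ℝ) :=
  value_le fun _ _ _ _ hT hadm => EReal.coe_le_coe (h.running_le hT.le hadm)

variable [Nonempty (Fin M)]

theorem value_nonneg (h : p.StrictBound lam δ) (x : Fin n → ℝ) : 0 ≤ p.value x := by
  obtain ⟨w, ξ, hadm, hrun⟩ := h.exists_running_nonneg (Classical.arbitrary _) zero_le_one x
  exact (EReal.coe_nonneg.2 hrun).trans (hadm.running_le_value one_pos)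

theorem coe_realValue (h : p.StrictBound lam δ) (x : Fin n → ℝ) :
    (p.realValue x : EReal) = p.value x :=
  EReal.coe_toReal (ne_top_of_le_ne_top (EReal.coe_ne_top _) (h.value_le_quadForm x))
    (ne_bot_of_le_ne_bot EReal.zero_ne_bot (h.value_nonneg x))

theorem realValue_nonneg (h : p.StrictBound lam δ) (x : Fin n → ℝ) : 0 ≤ p.realValue x :=
  EReal.toReal_nonneg (h.value_nonneg x)

theorem running_le_realValue (h : p.StrictBound lam δ) {x : Fin n → ℝ} {T : ℝ} (hT : 0 < T)
    {w : ℝ → Fin k → ℝ} {μ : ℝ → Fin M} {ξ : ℝ → Fin n → ℝ} (hadm : p.IsAdmissible x T w μ ξ) :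
    p.running T w μ ξ ≤ p.realValue x := by
  rw [← EReal.coe_le_coe_iff, h.coe_realValue]
  exact hadm.running_le_value hT

theorem realValue_le (h : p.StrictBound lam δ) {x : Fin n → ℝ} {b : ℝ}
    (hb : ∀ ⦃T w μ ξ⦄, 0 < T → p.IsAdmissible x T w μ ξ → p.running T w μ ξ ≤ b) :
    p.realValue x ≤ b := by
  rw [← EReal.coe_le_coe_iff, h.coe_realValue]
  exact value_le fun _ _ _ _ hT hadm => EReal.coe_le_coe (hb hT hadm)

theorem realValue_le_quadForm (h : p.StrictBound lam δ) (x : Fin n → ℝ) :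
    p.realValue x ≤ quadForm (lam • 1) x :=
  h.realValue_le fun _ _ _ _ hT hadm => h.running_le hT.le hadm

theorem dominates_realValue (h : p.StrictBound lam δ) {τ : ℝ} (hτ : 0 ≤ τ) :
    p.Dominates Set.univ τ p.realValue p.realValue := by
  intro x w μ ξ hadm _
  rw [← le_sub_iff_add_le']
  refine h.realValue_le fun T w' μ' ξ' hT hadm' => ?_
  obtain ⟨hconcat, hrun⟩ := hadm.concat hτ hT.le hadm'
  linarith [h.running_le_realValue (add_pos_of_nonneg_of_pos hτ hT) hconcat]

theorem realValue_le_of_dominates (h : p.StrictBound lam δ) {τ : ℝ} (hτ : 0 < τ)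
    {f g : (Fin n → ℝ) → ℝ} (hf : ∀ x, p.realValue x ≤ f x) (hfg : p.Dominates Set.univ τ f g)
    (x : Fin n → ℝ) : p.realValue x ≤ g x := by
  refine h.realValue_le fun T w μ ξ hT hadm => ?_
  rcases lt_or_ge τ T with hlt | hge
  · obtain ⟨d, rfl⟩ := exists_add_of_le hlt.le
    have hd : 0 < d := pos_of_lt_add_right hlt
    obtain ⟨hleft, hright⟩ := hadm.split hτ.le hd.le
    rw [p.running_add hτ.le hd.le hadm.isDisturbance hadm.measurable hadm.isTrajectory.1]
    exact (add_le_add_right ((h.running_le_realValue hd hright).trans (hf _)) _).trans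
      (hfg hleft fun _ => Set.mem_univ _)
  · obtain ⟨d, rfl⟩ := exists_add_of_le hge
    have hd : 0 ≤ d := le_of_add_le_add_left (a := T) (by simpa using hge)
    obtain ⟨w', ξ', hadm', hrun'⟩ := h.exists_running_nonneg (Classical.arbitrary _) hd (ξ T)
    obtain ⟨hconcat, hrun⟩ := hadm.concat hT.le hd hadm'
    linarith [hfg hconcat fun _ => Set.mem_univ _,
      (h.realValue_nonneg _).trans (hf (concatAt T ξ ξ' (T + d)))]

end StrictBound

/-! ### The max-plus iterates -/

theorem semigroupAt_le {m : Fin M} {τ : ℝ} {F : (Fin n → ℝ) → EReal} {f g : (Fin n → ℝ) → ℝ}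
    (hF : ∀ x, F x ≤ f x) (hfg : p.Dominates {m} τ f g) (x : Fin n → ℝ) :
    p.semigroupAt m τ F x ≤ g x := by
  refine iSup_le fun w => iSup_le fun hw => iSup_le fun ξ => iSup_le fun hξ => ?_
  grw [hF (ξ τ), ← EReal.coe_add, hfg ⟨hw, measurable_const, hξ⟩ fun _ => rfl]

theorem le_semigroupAt {m : Fin M} {τ : ℝ} {F : (Fin n → ℝ) → EReal} {f g : (Fin n → ℝ) → ℝ}
    (hF : ∀ x, (f x : EReal) ≤ F x) (hfg : p.Achieves m τ f g) (x : Fin n → ℝ) :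
    (g x : EReal) ≤ p.semigroupAt m τ F x := by
  obtain ⟨w, ξ, hadm, hg⟩ := hfg x
  refine le_iSup_of_le w <| le_iSup_of_le hadm.isDisturbance <| le_iSup_of_le ξ <|
    le_iSup_of_le hadm.isTrajectory ?_
  grw [hg, EReal.coe_add, hF (ξ τ)]

theorem semigroupAt_mono {m : Fin M} {τ : ℝ} {F G : (Fin n → ℝ) → EReal} (hFG : ∀ x, F x ≤ G x)
    (x : Fin n → ℝ) : p.semigroupAt m τ F x ≤ p.semigroupAt m τ G x :=
  iSup_mono fun _ => iSup_mono fun _ => iSup_mono fun ξ => iSup_mono fun _ =>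
    add_le_add_right (hFG (ξ τ)) _

theorem propagate_zero (τ : ℝ) (i : Fin 0 → Fin M) (F : (Fin n → ℝ) → EReal) :
    p.propagate τ i F = F := by
  simp [propagate]

theorem propagate_succ (τ : ℝ) {N : ℕ} (i : Fin (N + 1) → Fin M) (F : (Fin n → ℝ) → EReal) :
    p.propagate τ i F =
      p.semigroupAt (i (Fin.last N)) τ (p.propagate τ (fun j => i j.castSucc) F) := by
  rw [propagate, List.ofFn_succ', List.concat_eq_append, List.foldl_append]
  rfl

theorem maxPlusIterate_succ (τ : ℝ) (N : ℕ) (F : (Fin n → ℝ) → EReal) :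
    p.maxPlusIterate τ (N + 1) F = p.maxPlusStep τ (p.maxPlusIterate τ N F) :=
  Function.iterate_succ_apply' _ _ _

theorem propagate_le_maxPlusIterate (τ : ℝ) {N : ℕ} (i : Fin N → Fin M)
    (F : (Fin n → ℝ) → EReal) (x : Fin n → ℝ) :
    p.propagate τ i F x ≤ p.maxPlusIterate τ N F x := by
  induction N generalizing x with
  | zero => rw [propagate_zero, maxPlusIterate, Function.iterate_zero_apply]
  | succ N ih =>
    rw [propagate_succ, maxPlusIterate_succ]
    exact (semigroupAt_mono (ih _) x).trans
      (le_iSup (fun m => p.semigroupAt m τ (p.maxPlusIterate τ N F) x) _)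

theorem maxPlusIterate_le_of_dominates {τ : ℝ} {F : (Fin n → ℝ) → EReal}
    {f : ℕ → (Fin n → ℝ) → ℝ} (hzero : ∀ x, F x ≤ f 0 x)
    (hsucc : ∀ j, p.Dominates Set.univ τ (f j) (f (j + 1))) (N : ℕ) (x : Fin n → ℝ) :
    p.maxPlusIterate τ N F x ≤ f N x := by
  induction N generalizing x with
  | zero => exact hzero x
  | succ N ih =>
    rw [maxPlusIterate_succ]
    exact iSup_le fun m =>
      semigroupAt_le ih (fun _ _ _ _ hadm _ => hsucc N hadm fun _ => Set.mem_univ _) x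

theorem Dominates.mono_right {U : Set (Fin M)} {τ : ℝ} {f g g' : (Fin n → ℝ) → ℝ}
    (h : p.Dominates U τ f g) (hg : ∀ x, g x ≤ g' x) : p.Dominates U τ f g' :=
  fun _ _ _ _ hadm hU => (h hadm hU).trans (hg _)

theorem Dominates.convexCombination {U : Set (Fin M)} {τ : ℝ} {f f' g g' : (Fin n → ℝ) → ℝ}
    (hf : p.Dominates U τ f f') (hg : p.Dominates U τ g g') {α β : ℝ} (hα : 0 ≤ α) (hβ : 0 ≤ β)
    (hαβ : α + β = 1) :
    p.Dominates U τ (fun x => α * f x + β * g x) (fun x => α * f' x + β * g' x) := by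
  intro x w μ ξ hadm hU
  calc p.running τ w μ ξ + (α * f (ξ τ) + β * g (ξ τ))
      = α * (p.running τ w μ ξ + f (ξ τ)) + β * (p.running τ w μ ξ + g (ξ τ)) := by
        linear_combination -p.running τ w μ ξ * hαβ
    _ ≤ α * f' x + β * g' x := by
        gcongr
        exacts [hf hadm hU, hg hadm hU]

/-! ### The upper envelope of the Euler scheme -/

/-- The Euler scheme with time step `τ` along a word, started from `P`. -/
noncomputable def eulerWord (p : SwitchingLQ n k M) (τ : ℝ) (P : Matrix (Fin n) (Fin n) ℝ) {N : ℕ}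
    (i : Fin N → Fin M) : Matrix (Fin n) (Fin n) ℝ :=
  MethodInput.eulerWord i (p.input τ P)

/-- The supremum of the quadratic functions which the Euler scheme produces along all the words of
length `N`. -/
noncomputable def eulerEnvelope (p : SwitchingLQ n k M) (τ : ℝ) (P : Matrix (Fin n) (Fin n) ℝ)
    (N : ℕ) (x : Fin n → ℝ) : ℝ :=
  ⨆ i : Fin N → Fin M, quadForm (p.eulerWord τ P i) x

theorem eulerWord_zero (τ : ℝ) (P : Matrix (Fin n) (Fin n) ℝ) (i : Fin 0 → Fin M) :
    p.eulerWord τ P i = P :=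
  MethodInput.eulerWord_zero i _

theorem eulerWord_succ (τ : ℝ) (P : Matrix (Fin n) (Fin n) ℝ) {N : ℕ} (i : Fin (N + 1) → Fin M) :
    p.eulerWord τ P i = p.euler τ (p.eulerWord τ P fun j => i j.castSucc) (i (Fin.last N)) :=
  MethodInput.eulerWord_succ i _

theorem quadForm_eulerWord_le_eulerEnvelope (τ : ℝ) (P : Matrix (Fin n) (Fin n) ℝ) {N : ℕ}
    (i : Fin N → Fin M) (x : Fin n → ℝ) :
    quadForm (p.eulerWord τ P i) x ≤ p.eulerEnvelope τ P N x :=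
  le_ciSup (f := fun i : Fin N → Fin M => quadForm (p.eulerWord τ P i) x)
    (Set.finite_range _).bddAbove i

theorem exists_eulerEnvelope_eq [Nonempty (Fin M)] (τ : ℝ) (P : Matrix (Fin n) (Fin n) ℝ) (N : ℕ)
    (x : Fin n → ℝ) :
    ∃ i : Fin N → Fin M, p.eulerEnvelope τ P N x = quadForm (p.eulerWord τ P i) x := by
  obtain ⟨i, hi⟩ := exists_eq_ciSup_of_finite
    (f := fun i : Fin N → Fin M => quadForm (p.eulerWord τ P i) x)
  exact ⟨i, hi.symm⟩

theorem iSup_quadFun_eulerWord [Nonempty (Fin M)] (τ : ℝ) (P : Matrix (Fin n) (Fin n) ℝ) (N : ℕ)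
    (x : Fin n → ℝ) : ⨆ i : Fin N → Fin M, quadFun (p.eulerWord τ P i) x =
      (p.eulerEnvelope τ P N x : EReal) := by
  refine le_antisymm
    (iSup_le fun i => EReal.coe_le_coe (quadForm_eulerWord_le_eulerEnvelope τ P i x)) ?_
  obtain ⟨i, hi⟩ := p.exists_eulerEnvelope_eq τ P N x
  rw [hi]
  exact le_iSup (fun i : Fin N → Fin M => quadFun (p.eulerWord τ P i) x) i

namespace StepBounds

variable {lam τ a θ : ℝ} {P : Matrix (Fin n) (Fin n) ℝ}

theorem eulerWord_mem (h : p.StepBounds lam τ a θ) (hP : P ∈ loewnerInterval n 0 lam) {N : ℕ}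
    (i : Fin N → Fin M) : p.eulerWord τ P i ∈ loewnerInterval n 0 lam := by
  induction N with
  | zero => rwa [eulerWord_zero]
  | succ N ih =>
    rw [eulerWord_succ]
    exact h.euler_mem _ (ih _) _

theorem le_propagate (h : p.StepBounds lam τ a θ) (hP : P ∈ loewnerInterval n 0 lam) {N : ℕ}
    (i : Fin N → Fin M) (x : Fin n → ℝ) :
    (((1 - a) * quadForm (p.eulerWord τ P i) x : ℝ) : EReal) ≤
      p.propagate τ i (quadFun P) x := by
  induction N generalizing x with
  | zero =>
    rw [propagate_zero, eulerWord_zero, quadFun_eq_coe, EReal.coe_le_coe_iff]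
    linarith [mul_nonneg h.a_nonneg (quadForm_nonneg_of_mem hP x)]
  | succ N ih =>
    rw [propagate_succ, eulerWord_succ]
    exact le_semigroupAt (ih _) (h.achieves _ (h.eulerWord_mem hP _) _) x

theorem propagate_le (h : p.StepBounds lam τ a θ) (hP : P ∈ loewnerInterval n 0 lam) {N : ℕ}
    (i : Fin N → Fin M) (x : Fin n → ℝ) :
    p.propagate τ i (quadFun P) x ≤ (((1 + a) * quadForm (p.eulerWord τ P i) x : ℝ) : EReal) := by
  induction N generalizing x with
  | zero =>
    rw [propagate_zero, eulerWord_zero, quadFun_eq_coe, EReal.coe_le_coe_iff]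
    linarith [mul_nonneg h.a_nonneg (quadForm_nonneg_of_mem hP x)]
  | succ N ih =>
    rw [propagate_succ, eulerWord_succ]
    exact semigroupAt_le (ih _) (h.dominates _ (h.eulerWord_mem hP _) fun m hm y => by
      rw [Set.mem_singleton_iff.1 hm]) x

variable [Nonempty (Fin M)]

theorem eulerEnvelope_nonneg (h : p.StepBounds lam τ a θ) (hP : P ∈ loewnerInterval n 0 lam)
    (N : ℕ) (x : Fin n → ℝ) : 0 ≤ p.eulerEnvelope τ P N x := by
  obtain ⟨i, hi⟩ := p.exists_eulerEnvelope_eq τ P N x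
  exact hi ▸ quadForm_nonneg_of_mem (h.eulerWord_mem hP i) x

theorem eulerEnvelope_le (h : p.StepBounds lam τ a θ) (hP : P ∈ loewnerInterval n 0 lam)
    (N : ℕ) (x : Fin n → ℝ) : p.eulerEnvelope τ P N x ≤ quadForm (lam • 1) x := by
  obtain ⟨i, hi⟩ := p.exists_eulerEnvelope_eq τ P N x
  rw [hi, quadForm_smul]
  exact quadForm_le_of_mem (h.eulerWord_mem hP i) x

theorem dominates_eulerEnvelope (h : p.StepBounds lam τ a θ) (hP : P ∈ loewnerInterval n 0 lam)
    (N : ℕ) : p.Dominates Set.univ τ (fun x => (1 + a) * p.eulerEnvelope τ P N x)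
      (fun x => (1 + a) * p.eulerEnvelope τ P (N + 1) x) := by
  have ha := h.a_nonneg
  intro x w μ ξ hadm hU
  obtain ⟨i, hi⟩ := p.exists_eulerEnvelope_eq τ P N (ξ τ)
  simp only [hi]
  refine h.dominates _ (h.eulerWord_mem hP i)
    (g := fun y => (1 + a) * p.eulerEnvelope τ P (N + 1) y) (fun m _ y => ?_) hadm hU
  have hsnoc := p.quadForm_eulerWord_le_eulerEnvelope τ P (Fin.snoc i m : Fin (N + 1) → Fin M) y
  rw [eulerWord_succ] at hsnoc
  simp only [Fin.snoc_castSucc, Fin.snoc_last] at hsnoc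
  gcongr

theorem eulerEnvelope_le_maxPlusIterate (h : p.StepBounds lam τ a θ)
    (hP : P ∈ loewnerInterval n 0 lam) (N : ℕ) (x : Fin n → ℝ) :
    (((1 - a) * p.eulerEnvelope τ P N x : ℝ) : EReal) ≤ p.maxPlusIterate τ N (quadFun P) x := by
  obtain ⟨i, hi⟩ := p.exists_eulerEnvelope_eq τ P N x
  rw [hi]
  exact (h.le_propagate hP i x).trans (propagate_le_maxPlusIterate τ i _ x)

end StepBounds

/-! ### Convergence to the value function -/

namespace StepBounds

variable {lam δ τ a θ : ℝ} {P : Matrix (Fin n) (Fin n) ℝ} [Nonempty (Fin M)]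

theorem realValue_le_one_sub_mul (h : p.StepBounds lam τ a θ) (hb : p.StrictBound lam δ)
    (x : Fin n → ℝ) : p.realValue x ≤ (1 - θ) * quadForm (lam • 1) x :=
  hb.realValue_le_of_dominates h.τ_pos hb.realValue_le_quadForm h.decay x

theorem one_add_mul_realValue_le (h : p.StepBounds lam τ a θ) (hb : p.StrictBound lam δ)
    {H H' : (Fin n → ℝ) → ℝ} (hH : p.Dominates Set.univ τ H H') {r : ℝ} (hr : 0 ≤ r)
    (hle : ∀ x, (1 + r) * p.realValue x ≤ H x + r * quadForm (lam • 1) x) (x : Fin n → ℝ) :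
    (1 + r) * p.realValue x ≤ H' x + r * ((1 - θ) * quadForm (lam • 1) x) := by
  have hpos : 0 < 1 + r := by linarith
  have hdom := hH.convexCombination h.decay (α := 1 / (1 + r)) (β := r / (1 + r)) (by positivity)
    (by positivity) (by field_simp)
  have hcomb (u v : ℝ) : 1 / (1 + r) * u + r / (1 + r) * v = (u + r * v) / (1 + r) := by ring
  simp only [hcomb] at hdom
  rw [← le_div_iff₀' hpos]
  exact hb.realValue_le_of_dominates h.τ_pos (fun y => (le_div_iff₀' hpos).2 (hle y)) hdom x

/-- The multiplicative error of the Euler scheme does not accumulate: the weight of `lam I`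
decreases geometrically while the factor `1 + a` of the envelope stays the same. -/
theorem one_add_mul_realValue_le_eulerEnvelope (h : p.StepBounds lam τ a θ)
    (hb : p.StrictBound lam δ) (hP : P ∈ loewnerInterval n 0 lam) (N : ℕ) (x : Fin n → ℝ) :
    (1 + (1 - θ) ^ N / θ) * p.realValue x ≤
      (1 + a) * p.eulerEnvelope τ P N x + (1 - θ) ^ N / θ * quadForm (lam • 1) x := by
  have hθ := h.θ_pos
  have hq : 0 ≤ 1 - θ := sub_nonneg.2 h.θ_le_one
  induction N generalizing x with
  | zero =>
    have henv := mul_nonneg (by linarith [h.a_nonneg] : 0 ≤ 1 + a) (h.eulerEnvelope_nonneg hP 0 x)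
    refine le_add_of_nonneg_of_le henv ?_
    have hV := mul_le_mul_of_nonneg_left (h.realValue_le_one_sub_mul hb x)
      (by positivity : 0 ≤ 1 + θ)
    have hg := mul_nonneg (sq_nonneg θ)
      ((hb.realValue_nonneg x).trans (hb.realValue_le_quadForm x))
    field_simp
    linarith
  | succ N ih =>
    have hstep := h.one_add_mul_realValue_le hb (h.dominates_eulerEnvelope hP N)
      (r := (1 - θ) ^ N / θ) (by positivity) ih x
    have hdecr : 0 ≤ (1 - θ) ^ N * p.realValue x := mul_nonneg (by positivity)
      (hb.realValue_nonneg x)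
    have hr : (1 - θ) ^ (N + 1) / θ = (1 - θ) ^ N / θ * (1 - θ) := by ring
    have hr' : (1 - θ) ^ N / θ * θ = (1 - θ) ^ N := by field_simp
    rw [hr]
    linear_combination hstep + hdecr - p.realValue x * hr'

theorem realValue_le_eulerEnvelope (h : p.StepBounds lam τ a θ) (hb : p.StrictBound lam δ)
    (hP : P ∈ loewnerInterval n 0 lam) (N : ℕ) (x : Fin n → ℝ) :
    p.realValue x ≤
      (1 + a) * p.eulerEnvelope τ P N x + (1 - θ) ^ N / θ * quadForm (lam • 1) x := by
  refine le_trans ?_ (h.one_add_mul_realValue_le_eulerEnvelope hb hP N x)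
  have hr : 0 ≤ (1 - θ) ^ N / θ := div_nonneg (pow_nonneg (sub_nonneg.2 h.θ_le_one) N) h.θ_pos.le
  exact le_mul_of_one_le_left (hb.realValue_nonneg x) (by linarith)

theorem maxPlusIterate_le (h : p.StepBounds lam τ a θ) (hb : p.StrictBound lam δ)
    (hP : P ∈ loewnerInterval n 0 lam) (N : ℕ) (x : Fin n → ℝ) :
    p.maxPlusIterate τ N (quadFun P) x ≤
      ((p.realValue x + (1 - θ) ^ N * quadForm (lam • 1) x : ℝ) : EReal) := by
  have hq : 0 ≤ 1 - θ := sub_nonneg.2 h.θ_le_one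
  have hpow (j : ℕ) : 0 ≤ (1 - θ) ^ j := pow_nonneg hq j
  have hiter := maxPlusIterate_le_of_dominates (p := p) (τ := τ) (F := quadFun P)
    (f := fun j x => (1 - (1 - θ) ^ j) * p.realValue x + (1 - θ) ^ j * quadForm (lam • 1) x)
    (fun y => ?_) (fun j => ?_) N x
  · refine hiter.trans (EReal.coe_le_coe ?_)
    linarith [mul_nonneg (hpow N) (hb.realValue_nonneg x)]
  · rw [quadFun_eq_coe, EReal.coe_le_coe_iff]
    simpa [quadForm_smul] using quadForm_le_of_mem hP y
  · refine ((hb.dominates_realValue h.τ_pos.le).convexCombination h.decay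
      (sub_nonneg.2 (pow_le_one₀ hq (sub_le_self 1 h.θ_pos.le))) (hpow j)
      (sub_add_cancel _ _)).mono_right fun y => ?_
    rw [pow_succ]
    linarith [mul_nonneg (mul_nonneg (hpow j) h.θ_pos.le) (hb.realValue_nonneg y)]

end StepBounds

/-! ### Accuracy -/

namespace StepBounds

variable {lam δ τ a θ ε : ℝ} {P : Matrix (Fin n) (Fin n) ℝ} {N : ℕ}

theorem one_sub_pow_le_div (h : p.StepBounds lam τ a θ) (N : ℕ) :
    (1 - θ) ^ N ≤ (1 - θ) ^ N / θ :=
  le_div_self (pow_nonneg (sub_nonneg.2 h.θ_le_one) N) h.θ_pos h.θ_le_one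

theorem approxWithin_propagate (h : p.StepBounds lam τ a θ) (hP : P ∈ loewnerInterval n 0 lam)
    (haε : 2 * a * lam ≤ ε) (i : Fin N → Fin M) :
    ApproxWithin ε (p.propagate τ i (quadFun P)) (quadFun (p.eulerWord τ P i)) := by
  have herr (x : Fin n → ℝ) : a * quadForm (p.eulerWord τ P i) x ≤ ε * (x ⬝ᵥ x) := by
    have hmem := h.eulerWord_mem hP i
    have hnonneg := mul_nonneg h.a_nonneg (quadForm_nonneg_of_mem hmem x)
    have hle := mul_le_mul_of_nonneg_left (quadForm_le_of_mem hmem x) h.a_nonneg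
    have haε' := mul_le_mul_of_nonneg_right haε (quadForm_one_nonneg x)
    rw [quadForm_one] at *
    linarith
  have happrox : ApproxWithin ε (quadFun (p.eulerWord τ P i)) (p.propagate τ i (quadFun P)) := by
    rw [funext (quadFun_eq_coe (p.eulerWord τ P i))]
    exact .of_coe_le_of_le_coe (h.le_propagate hP i) (h.propagate_le hP i)
      (fun x => by linarith [herr x]) fun x => by linarith [herr x]
  exact happrox.symm

variable [Nonempty (Fin M)]

theorem error_le (h : p.StepBounds lam τ a θ) (hP : P ∈ loewnerInterval n 0 lam)
    (haε : 2 * a * lam ≤ ε) (hθε : (1 - θ) ^ N / θ * lam ≤ ε) (x : Fin n → ℝ) :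
    2 * (a * p.eulerEnvelope τ P N x) + (1 - θ) ^ N / θ * quadForm (lam • 1) x ≤
      ε * (x ⬝ᵥ x) := by
  have henv := mul_le_mul_of_nonneg_left (h.eulerEnvelope_le hP N x) h.a_nonneg
  have haε' := mul_le_mul_of_nonneg_right haε (quadForm_one_nonneg x)
  have hθε' := mul_le_mul_of_nonneg_right hθε (quadForm_one_nonneg x)
  rw [quadForm_smul] at henv ⊢
  rw [quadForm_one] at *
  linarith

theorem approxWithin_maxPlusIterate (h : p.StepBounds lam τ a θ) (hb : p.StrictBound lam δ)
    (hP : P ∈ loewnerInterval n 0 lam) (haε : 2 * a * lam ≤ ε)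
    (hθε : (1 - θ) ^ N / θ * lam ≤ ε) :
    ApproxWithin ε p.value (p.maxPlusIterate τ N (quadFun P)) := by
  rw [← funext hb.coe_realValue]
  refine ApproxWithin.of_coe_le_of_le_coe (h.eulerEnvelope_le_maxPlusIterate hP N)
    (h.maxPlusIterate_le hb hP N) (fun x => ?_) fun x => ?_
  · linarith [h.realValue_le_eulerEnvelope hb hP N x, h.error_le hP haε hθε x]
  · have hpow := mul_le_mul_of_nonneg_right (h.one_sub_pow_le_div N)
      ((hb.realValue_nonneg x).trans (hb.realValue_le_quadForm x))
    linarith [h.error_le hP haε hθε x, mul_nonneg h.a_nonneg (h.eulerEnvelope_nonneg hP N x)]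

theorem approxWithin_iSup_quadFun_eulerWord (h : p.StepBounds lam τ a θ)
    (hb : p.StrictBound lam δ) (hP : P ∈ loewnerInterval n 0 lam)
    (haε : 2 * a * lam ≤ ε) (hθε : (1 - θ) ^ N / θ * lam ≤ ε) :
    ApproxWithin ε p.value
      (fun x => ⨆ i : Fin N → Fin M, quadFun (p.eulerWord τ P i) x) := by
  have henv (x : Fin n → ℝ) : 0 ≤ a * p.eulerEnvelope τ P N x :=
    mul_nonneg h.a_nonneg (h.eulerEnvelope_nonneg hP N x)
  simp only [iSup_quadFun_eulerWord]
  rw [← funext hb.coe_realValue]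
  refine ApproxWithin.of_coe_le_of_le_coe (fun x => le_rfl) (fun x => le_rfl)
    (fun x => ?_) fun x => ?_
  · linarith [h.realValue_le_eulerEnvelope hb hP N x, h.error_le hP haε hθε x, henv x]
  · have hiter := EReal.coe_le_coe_iff.1 <|
      (h.eulerEnvelope_le_maxPlusIterate hP N x).trans (h.maxPlusIterate_le hb hP N x)
    have hpow := mul_le_mul_of_nonneg_right (h.one_sub_pow_le_div N)
      ((hb.realValue_nonneg x).trans (hb.realValue_le_quadForm x))
    linarith [h.error_le hP haε hθε x, henv x]

end StepBounds

/-! ### Time step and number of iterations -/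

theorem one_sub_pow_le_of_log_le {q ε : ℝ} {N j : ℕ} (hq : q ≤ 1) (hε : 0 < ε)
    (hN : j * -Real.log ε ≤ N * q) : (1 - q) ^ N ≤ ε ^ j := by
  calc (1 - q) ^ N ≤ Real.exp (-q) ^ N :=
        pow_le_pow_left₀ (sub_nonneg.2 hq) (Real.one_sub_le_exp_neg q) N
    _ ≤ ε ^ j := by
        rw [← Real.exp_nat_mul, ← Real.exp_log (pow_pos hε j), Real.exp_le_exp, Real.log_pow]
        linarith

theorem tendsto_div_const_nhdsGT_zero {b : ℝ} (hb : 0 < b) :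
    Filter.Tendsto (fun ε : ℝ => ε / b) (𝓝[>] 0) (𝓝[>] 0) := by
  refine tendsto_nhdsWithin_iff.2 ⟨?_, ?_⟩
  · have hcont : Continuous fun ε : ℝ => ε / b := by fun_prop
    simpa using (hcont.tendsto 0).mono_left nhdsWithin_le_nhds
  · filter_upwards [self_mem_nhdsWithin] with ε hε using div_pos hε hb

/-- The geometric term is at most `ε ^ 3 / (κ ε / b)`, which is `o(ε)`. -/
theorem exists_iterations_geom_error_le {κ b lam : ℝ} (hκ : 0 < κ) (hb : 0 < b) (hlam : 0 < lam) :
    ∃ C, 0 < C ∧ ∀ᶠ ε in 𝓝[>] (0 : ℝ), κ * (ε / b) ≤ 1 → ∃ N : ℕ,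
      (N : ℝ) ≤ C * (-Real.log ε / ε) ∧
      (1 - κ * (ε / b)) ^ N / (κ * (ε / b)) * lam ≤ ε := by
  refine ⟨3 * b / κ + 1, by positivity, ?_⟩
  filter_upwards [Ioo_mem_nhdsGT (by positivity : 0 < min (κ / (b * lam)) (Real.exp (-1)))]
    with ε hε hθ
  obtain ⟨hε₀, hε₁⟩ := hε
  obtain ⟨hεκ, hεe⟩ := lt_min_iff.1 hε₁
  have hlog : 1 ≤ -Real.log ε := by
    linarith [(Real.log_lt_iff_lt_exp hε₀).2 hεe]
  have hε_le_one : ε ≤ 1 := hεe.le.trans (Real.exp_le_one_iff.2 (by norm_num))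
  have hone : 1 ≤ -Real.log ε / ε := (one_le_div hε₀).2 (hε_le_one.trans hlog)
  refine ⟨⌈3 * b / κ * (-Real.log ε / ε)⌉₊, ?_, ?_⟩
  · linarith [Nat.ceil_lt_add_one (by positivity : 0 ≤ 3 * b / κ * (-Real.log ε / ε))]
  · have hN := Nat.le_ceil (3 * b / κ * (-Real.log ε / ε))
    set N := ⌈3 * b / κ * (-Real.log ε / ε)⌉₊
    have hpow : (1 - κ * (ε / b)) ^ N ≤ ε ^ 3 := by
      refine one_sub_pow_le_of_log_le hθ hε₀ ?_
      calc ((3 : ℕ) : ℝ) * -Real.log ε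
          = 3 * b / κ * (-Real.log ε / ε) * (κ * (ε / b)) := by push_cast; field_simp
        _ ≤ N * (κ * (ε / b)) := by gcongr
    calc (1 - κ * (ε / b)) ^ N / (κ * (ε / b)) * lam ≤ ε ^ 3 / (κ * (ε / b)) * lam := by gcongr
      _ = ε * (ε * (b * lam) / κ) := by field_simp
      _ ≤ ε := by
        refine mul_le_of_le_one_right hε₀.le ((div_le_one hκ).2 ?_)
        exact ((lt_div_iff₀ (by positivity)).1 hεκ).le

theorem StrictBound.exists_stepBounds_error_le {lam δ : ℝ} (h : p.StrictBound lam δ) :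
    ∃ C, 0 < C ∧ ∀ᶠ ε in 𝓝[>] (0 : ℝ), ∃ (τ a θ : ℝ) (N : ℕ), p.StepBounds lam τ a θ ∧
      (N : ℝ) ≤ C * (-Real.log ε / ε) ∧ 2 * a * lam ≤ ε ∧ (1 - θ) ^ N / θ * lam ≤ ε := by
  obtain ⟨κ, c, hκ, hc, hstep⟩ := h.exists_stepBounds
  have hlam := h.lam_pos
  have hb : 0 < 2 * c * lam := by positivity
  obtain ⟨C, hC, hN⟩ := exists_iterations_geom_error_le hκ hb hlam
  refine ⟨C, hC, ?_⟩
  filter_upwards [hN, (tendsto_div_const_nhdsGT_zero hb).eventually hstep] with ε hN hstep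
  obtain ⟨N, hNC, hgeom⟩ := hN hstep.θ_le_one
  refine ⟨_, _, _, N, hstep, hNC, le_of_eq ?_, hgeom⟩
  field_simp

/-! ### The constants -/

/-- `(cA - √(cA² - cD β)) / β` is the smaller root of `β t² - 2 cA t + cD`. -/
theorem exists_strict_supersolution {cA β cD mD lam : ℝ} (hcA : 0 < cA) (hβ : 0 < β)
    (hmD : 0 < mD) (hmDcD : mD ≤ cD) (hdisc : cD * β < cA ^ 2)
    (hgap : (cA - √(cA ^ 2 - cD * β)) ^ 2 < β * mD) (hlam : lam < √(mD / β)) :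
    ∃ t, lam ≤ t ∧ 0 < t ∧ β * t ^ 2 - 2 * cA * t + cD < 0 ∧ β * t ^ 2 < mD := by
  set d := √(cA ^ 2 - cD * β)
  have hd_pos : 0 < d := Real.sqrt_pos.2 (sub_pos.2 hdisc)
  have hd_sq : d ^ 2 = cA ^ 2 - cD * β := Real.sq_sqrt (sub_nonneg.2 hdisc.le)
  have hcDβ : 0 < cD * β := mul_pos (hmD.trans_le hmDcD) hβ
  have hdcA : d < cA := lt_of_pow_lt_pow_left₀ 2 hcA.le (by linarith)
  have hroot : (cA - d) / β < √(mD / β) := by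
    refine Real.lt_sqrt_of_sq_lt ?_
    rw [div_pow, div_lt_div_iff₀ (by positivity) hβ]
    nlinarith
  obtain ⟨t, hlower, hupper⟩ := exists_between (max_lt hlam hroot)
  obtain ⟨hlamt, hroott⟩ := max_lt_iff.1 hlower
  have ht : 0 < t := (div_pos (sub_pos.2 hdcA) hβ).trans hroott
  have htmD : β * t ^ 2 < mD := (lt_div_iff₀' hβ).1 ((Real.lt_sqrt ht.le).1 hupper)
  refine ⟨t, hlamt.le, ht, ?_, htmD⟩
  have hleft : cA - d < β * t := (div_lt_iff₀' hβ).1 hroott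
  have hright : β * t < cA + d := by
    refine lt_of_pow_lt_pow_left₀ 2 (by positivity) ?_
    calc (β * t) ^ 2 = β * (β * t ^ 2) := by ring
      _ < β * cD := by gcongr; exact htmD.trans_le hmDcD
      _ < (cA + d) ^ 2 := by nlinarith
  refine pos_iff_neg_of_mul_neg ?_ |>.1 hβ
  calc β * (β * t ^ 2 - 2 * cA * t + cD) = (β * t - cA) ^ 2 - d ^ 2 := by rw [hd_sq]; ring
    _ < 0 := sub_neg.2 (sq_lt_sq' (by linarith) (by linarith))

theorem quadForm_S_le {cσ : ℝ} (hcσ : 0 ≤ cσ) {m : Fin M}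
    (hσ : ∀ w, (p.sig m *ᵥ w) ⬝ᵥ (p.sig m *ᵥ w) ≤ cσ ^ 2 * (w ⬝ᵥ w)) (y : Fin n → ℝ) :
    quadForm (p.S m) y ≤ cσ ^ 2 / p.γ ^ 2 * quadForm 1 y := by
  open scoped Matrix.Norms.L2Operator in
  have hnorm : ‖(p.sig m)ᵀ‖ ≤ cσ :=
    l2_opNorm_transpose (p.sig m) ▸ l2_opNorm_le_of_mulVec_dotProduct_self_le hcσ hσ
  have hy : ((p.sig m)ᵀ *ᵥ y) ⬝ᵥ ((p.sig m)ᵀ *ᵥ y) ≤ cσ ^ 2 * (y ⬝ᵥ y) := by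
    grw [mulVec_dotProduct_self_le, hnorm]
    exact dotProduct_self_nonneg_real y
  rw [quadForm_S, quadForm_one]
  calc 1 / p.γ ^ 2 * (1 / 2 * (((p.sig m)ᵀ *ᵥ y) ⬝ᵥ ((p.sig m)ᵀ *ᵥ y)))
      ≤ 1 / p.γ ^ 2 * (1 / 2 * (cσ ^ 2 * (y ⬝ᵥ y))) := by gcongr
    _ = cσ ^ 2 / p.γ ^ 2 * (1 / 2 * (y ⬝ᵥ y)) := by ring

theorem quadForm_mul_S_mul_le {β lam : ℝ} (hβ : 0 ≤ β) (hlam : 0 < lam) {m : Fin M}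
    (hS : ∀ y, quadForm (p.S m) y ≤ β * quadForm 1 y) {R : Matrix (Fin n) (Fin n) ℝ}
    (hR : R ∈ loewnerInterval n 0 lam) (x : Fin n → ℝ) :
    quadForm (R * p.S m * R) x ≤ β * lam ^ 2 * quadForm 1 x := by
  open scoped Matrix.Norms.L2Operator in
  have hnorm : ‖R‖ ≤ lam := l2_opNorm_le_of_mem_loewnerInterval hR hlam
  have hRx : (R *ᵥ x) ⬝ᵥ (R *ᵥ x) ≤ lam ^ 2 * (x ⬝ᵥ x) := by
    grw [mulVec_dotProduct_self_le, hnorm]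
    exact dotProduct_self_nonneg_real x
  rw [quadForm_mul_mul (mem_loewnerInterval_iff.1 hR).1]
  calc quadForm (p.S m) (R *ᵥ x) ≤ β * (1 / 2 * ((R *ᵥ x) ⬝ᵥ (R *ᵥ x))) := by
        simpa only [quadForm_one] using hS (R *ᵥ x)
    _ ≤ β * (1 / 2 * (lam ^ 2 * (x ⬝ᵥ x))) := by gcongr
    _ = β * lam ^ 2 * quadForm 1 x := by rw [quadForm_one]; ring

theorem quadForm_ric_smul_one (p : SwitchingLQ n k M) (m : Fin M) (lam : ℝ) (x : Fin n → ℝ) :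
    quadForm (p.ric m (lam • 1)) x =
      lam * (x ⬝ᵥ (p.A m *ᵥ x)) + lam ^ 2 * quadForm (p.S m) x + quadForm (p.D m) x := by
  rw [ric, quadForm_riccati (Matrix.isSymm_one.smul lam)]
  simp only [quadForm, Matrix.smul_mulVec, Matrix.one_mulVec, Matrix.mulVec_smul,
    smul_dotProduct, dotProduct_smul, smul_eq_mul]
  ring

theorem exists_strictBound_of_le {cA β cD mD lam : ℝ} (hγ : p.γ ≠ 0)
    (hA : ∀ m x, x ⬝ᵥ (p.A m *ᵥ x) ≤ -cA * (x ⬝ᵥ x))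
    (hS : ∀ m y, quadForm (p.S m) y ≤ β * quadForm 1 y)
    (hD : ∀ m, p.D m ∈ loewnerInterval n mD cD) (hβ : 0 ≤ β) (hlam : 0 < lam)
    (hsuper : β * lam ^ 2 - 2 * cA * lam + cD < 0) (hgap : β * lam ^ 2 < mD) :
    ∃ δ, p.StrictBound lam δ := by
  have hDbounds (m : Fin M) := mem_loewnerInterval_iff.1 (hD m)
  have hden : 0 < 1 + β * lam ^ 2 := by positivity
  obtain ⟨δ, hδ, hδmin⟩ := exists_between
    (lt_min (neg_pos.2 hsuper) (div_pos (sub_pos.2 hgap) hden))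
  obtain ⟨hδsuper, hδgap⟩ := lt_min_iff.1 hδmin
  rw [lt_div_iff₀ hden] at hδgap
  refine ⟨δ, hγ, hlam, hδ, fun m => (hDbounds m).1, fun m x => ?_, fun R hR m x => ?_⟩
  · rw [quadForm_ric_smul_one]
    have hAx := mul_le_mul_of_nonneg_left (hA m x) hlam.le
    have hSx := mul_le_mul_of_nonneg_left (hS m x) (sq_nonneg lam)
    have hδx := mul_le_mul_of_nonneg_right hδsuper.le (quadForm_one_nonneg x)
    have hDx := ((hDbounds m).2 x).2
    rw [quadForm_one] at *
    linarith
  · have hRSR := mul_le_mul_of_nonneg_left (quadForm_mul_S_mul_le hβ hlam (hS m) hR x)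
      (by positivity : 0 ≤ 1 + δ)
    have hδx := mul_le_mul_of_nonneg_right hδgap.le (quadForm_one_nonneg x)
    linarith [((hDbounds m).2 x).1]

theorem exists_strictBound_of_isEmpty [IsEmpty (Fin n)] (hγ : p.γ ≠ 0) {lam : ℝ}
    (hlam : 0 < lam) : ∃ δ, p.StrictBound lam δ :=
  ⟨1, hγ, hlam, one_pos, fun _ => Matrix.IsSymm.ext isEmptyElim, fun _ _ => by simp [quadForm],
    fun _ _ _ _ => by simp [quadForm]⟩

theorem D_mem_loewnerInterval {cA cσ cD mD : ℝ} (h₁ : p.Assumption1 cA cσ cD)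
    (h₂ : p.Assumption2 cA cσ cD mD) (m : Fin M) : p.D m ∈ loewnerInterval n mD cD := by
  refine mem_loewnerInterval_iff.2 ⟨?_, fun x => ?_⟩
  · rw [Matrix.IsSymm, ← Matrix.conjTranspose_eq_transpose_of_trivial]
    exact (h₁.D_posDef m).isHermitian
  · rw [quadForm_one, quadForm]
    constructor <;> linarith [h₁.D_le m x, h₂.le_D m x]

theorem exists_strictBound [Nonempty (Fin M)] {cA cσ cD mD lam : ℝ} (h₁ : p.Assumption1 cA cσ cD)
    (h₂ : p.Assumption2 cA cσ cD mD) (hlam : lam < √(mD * p.γ ^ 2 / cσ ^ 2)) :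
    ∃ lam' δ, lam ≤ lam' ∧ p.StrictBound lam' δ := by
  have hγ := h₁.γ_pos
  have hcσ := h₁.cσ_pos
  rcases isEmpty_or_nonempty (Fin n) with _ | ⟨⟨j⟩⟩
  · obtain ⟨δ, hb⟩ := exists_strictBound_of_isEmpty (p := p) hγ.ne'
      (lt_max_of_lt_right one_pos : 0 < max lam 1)
    exact ⟨_, δ, le_max_left _ _, hb⟩
  have hD := D_mem_loewnerInterval h₁ h₂
  have hmDcD : mD ≤ cD := by
    have hj := (mem_loewnerInterval_iff.1 (hD (Classical.arbitrary _))).2 (Pi.single j 1)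
    simpa [quadForm_one] using hj.1.trans hj.2
  have hdisc := h₁.gap
  have hgap := h₂.gap
  have hβ : 0 < cσ ^ 2 / p.γ ^ 2 := by positivity
  rw [mul_div_assoc] at hdisc hgap
  rw [← div_div_eq_mul_div] at hlam
  obtain ⟨t, hlamt, ht, hsuper, htmD⟩ :=
    exists_strict_supersolution h₁.cA_pos hβ h₂.mD_pos hmDcD hdisc hgap hlam
  obtain ⟨δ, hb⟩ := exists_strictBound_of_le hγ.ne' h₁.stable
    (fun m => quadForm_S_le hcσ.le (h₁.sig_le m)) hD hβ.le ht hsuper htmD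
  exact ⟨t, δ, hlamt, hb⟩

end SwitchingLQ

theorem mainTheorem4_general :
    ∃ (c : ℝ)
      (Q : ∀ n M N : ℕ, (Fin N → Fin M) → MethodInput n M → Matrix (Fin n) (Fin n) ℝ)
      (cost : ℕ → ℕ → ℕ → ℕ),
      (∀ n M N : ℕ, ComputedWith (Q n M N) (cost n M N)) ∧
      ∀ (n k M : ℕ) (p : SwitchingLQ n k M) (cA cσ cD mD lam : ℝ),
        0 < M → p.Assumption1 cA cσ cD → p.Assumption2 cA cσ cD mD →
        lam < √(mD * p.γ ^ 2 / cσ ^ 2) →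
        ∃ C : ℝ, 0 < C ∧ ∀ᶠ ε in 𝓝[>] (0 : ℝ), ∃ (τ : ℝ) (N : ℕ), 0 < τ ∧
          (N : ℝ) ≤ C * (-Real.log ε / ε) ∧
          (2 ≤ M → (cost n M N : ℝ) ≤ c * (M : ℝ) ^ (C * (-Real.log ε / ε)) * (n : ℝ) ^ 3) ∧
          ∀ P₀ ∈ loewnerInterval n 0 lam,
            ApproxWithin ε p.value (p.maxPlusIterate τ N (quadFun P₀)) ∧
            (∀ i : Fin N → Fin M,
              ApproxWithin ε (p.propagate τ i (quadFun P₀))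
                (quadFun (Q n M N i (p.input τ P₀)))) ∧
            ApproxWithin ε p.value (fun x => ⨆ i, quadFun (Q n M N i (p.input τ P₀)) x) := by
  refine ⟨26, fun n M N => MethodInput.eulerWord, MethodInput.eulerCost,
    MethodInput.computedWith_eulerWord, ?_⟩
  intro n k M p cA cσ cD mD lam hM h₁ h₂ hlam
  have : Nonempty (Fin M) := Fin.pos_iff_nonempty.1 hM
  obtain ⟨lam', δ, hle, hb⟩ := SwitchingLQ.exists_strictBound h₁ h₂ hlam
  obtain ⟨C, hC, hstep⟩ := hb.exists_stepBounds_error_le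
  refine ⟨C, hC, hstep.mono ?_⟩
  rintro ε ⟨τ, a, θ, N, h, hN, haε, hθε⟩
  refine ⟨τ, N, h.τ_pos, hN, fun hM₂ => MethodInput.eulerCost_le_rpow hM₂ n hN, fun P₀ hP₀ => ?_⟩
  have hP : P₀ ∈ loewnerInterval n 0 lam' := loewnerInterval_subset le_rfl hle hP₀
  exact ⟨h.approxWithin_maxPlusIterate hb hP haε hθε, h.approxWithin_propagate hP haε,
    h.approxWithin_iSup_quadFun_eulerWord hb hP haε hθε⟩

theorem mainTheorem4 :
    ∃ (c : ℝ)
      (Q : ∀ n M N : ℕ, (Fin N → Fin M) → MethodInput n M → Matrix (Fin n) (Fin n) ℝ)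
      (cost : ℕ → ℕ → ℕ → ℕ),
      (∀ n M N : ℕ, ComputedWith (Q n M N) (cost n M N)) ∧
      ∀ (n k M : ℕ) (p : SwitchingLQ n k M) (cA cσ cD mD lam e : ℝ),
        0 < M → p.Assumption1 cA cσ cD → p.Assumption2 cA cσ cD mD →
        lam < √(mD * p.γ ^ 2 / cσ ^ 2) → 0 < e →
        ∃ C : ℝ, 0 < C ∧ ∀ᶠ ε in 𝓝[>] (0 : ℝ), ∃ (τ : ℝ) (N : ℕ), 0 < τ ∧
          -- the number of iterations
          (N : ℝ) ≤ C * (-Real.log ε / ε) ∧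
          -- the number of arithmetic operations
          (2 ≤ M → (cost n M N : ℝ) ≤ c * (M : ℝ) ^ (C * (-Real.log ε / ε)) * (n : ℝ) ^ 3) ∧
          ∀ P₀ ∈ loewnerInterval n e lam,
            -- `N` iterations of the max-plus method approximate `V` to accuracy `ε`
            ApproxWithin ε p.value (p.maxPlusIterate τ N (quadFun P₀)) ∧
            -- the program computes the quadratic functions of the method to accuracy `ε`
            (∀ i : Fin N → Fin M,
              ApproxWithin ε (p.propagate τ i (quadFun P₀))
                (quadFun (Q n M N i (p.input τ P₀)))) ∧
            -- and the supremum of its output approximates `V` to accuracy `ε`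
            ApproxWithin ε p.value (fun x => ⨆ i, quadFun (Q n M N i (p.input τ P₀)) x) := by
  obtain ⟨c, Q, cost, hcomputed, h⟩ := mainTheorem4_general
  refine ⟨c, Q, cost, hcomputed, fun n k M p cA cσ cD mD lam e hM h₁ h₂ hlam he => ?_⟩
  obtain ⟨C, hC, hacc⟩ := h n k M p cA cσ cD mD lam hM h₁ h₂ hlam
  refine ⟨C, hC, hacc.mono fun ε ⟨τ, N, hτ, hN, hcost, happrox⟩ => ?_⟩
  exact ⟨τ, N, hτ, hN, hcost, fun P₀ hP₀ => happrox P₀ (loewnerInterval_subset he.le le_rfl hP₀)⟩
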